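/- **Setting.** Let $D\subset\mathbb R^2$ be a polygonal domain with a conforming triangulation $\hat{\mathcal T}_0$ whose edges are labelled $0$ or $1$ such that each triangle has exactly one edge labelled $0$. Newest vertex bisection of a triangle with edge labels $(i,i,i-1)$ bisects the edge with the lowest label; both halves and the new edge get label $i+1$. Write $\mathcal T'\ge\mathcal T$ if $\mathcal T'$ is generated from $\mathcal T$ by finitely many bisections, and let $\hat{\mathcal T}_{j+1}$ arise from $\hat{\mathcal T}_j$ by two passes of bisection over all triangles. Let $V=H^1_0(D)$ with $\|v\|_V=\|\nabla v\|_{L_2(D)}$, let $V(\mathcal T)\subset V$ be the functions that are affine on each triangle of $\mathcal T$, and assume $V(\hat{\mathcal T}_0)\ne\{0\}$. Let $\Psi=(\psi_\lambda)_{\lambda\in\Theta}$ be the family of all hat functions at interior nodes of $\hat{\mathcal T}_j$, $j=0,1,2,\dots$, normalized by $\|\psi_\lambda\|_V=1$. Numbers $c_\Psi,C_\Psi>0$ are called frame bounds if $$c_\Psi^2\|\xi\|_{V'}^2\le\sum_{\lambda\in\Theta}|\langle\xi,\psi_\lambda\rangle|^2\le C_\Psi^2\|\xi\|_{V'}^2\qquad\text{for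 all }\xi\in V'.$$ Let $\mathcal M$ be countable, $Y=[-1,1]^{\mathcal M}$ with the product $\sigma$ of the uniform probability measures, $\theta_0,\theta_\mu\in L_\infty(D)$ for $\mu\in\mathcal M$, $f\in L_2(D)$, and $a(y)=\theta_0+\sum_{\mu\in\mathcal M}y_\mu\theta_\mu$. Assume that $\sum_\mu|\theta_\mu|$ is finite a.e. in $D$ and that $$c_B=\operatorname*{ess\,inf}_D\Bigl\{\theta_0-\sum_{\mu\in\mathcal M}|\theta_\mu|\Bigr\}>0,\qquad\text{and put}\quad C_B=\sup_{y\in Y}\|a(y)\|_{L_\infty(D)}.$$ On $\mathcal V=L_2(Y,V,\sigma)$ let $\langle Bv,w\rangle=\int_Y\int_D a(y)\nabla v(y)\cdot\nabla w(y)\,dx\,d\sigma(y)$, $\Phi(w)=\int_Y\int_D f\,w(y)\,dx\,d\sigma(y)$ and $\|v\|_B=\langle Bv,v\rangle^{1/2}$. Let $u\in\mathcal V$ be the solution of $Bu=\Phi$. Let $L_\nu$, $\nu\in\mathcal F$ (the finitely supported multi-indices in $\mathbb N_0^{\mathcal M}$), be the orthonormal product Legendre polynomials, and for $w\in\mathcal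 V$ let $\mathbf r(w)=(\langle[Bw-f]_\nu,\psi_\lambda\rangle)_{\nu\in\mathcal F,\lambda\in\Theta}$ with $$\langle[Bw-f]_\nu,v\rangle=\int_Y\Bigl(\int_D a(y)\nabla w(y)\cdot\nabla v-f v\,dx\Bigr)L_\nu(y)\,d\sigma(y).$$ For a family $\mathbb T=(\mathcal T_\nu)_{\nu\in F}$ of conforming meshes $\mathcal T_\nu\ge\hat{\mathcal T}_0$ with $F\subset\mathcal F$ finite, put $\mathcal V(\mathbb T)=\{\sum_{\nu\in F}v_\nu L_\nu:\ v_\nu\in V(\mathcal T_\nu)\}$. The Galerkin solution $u_{\mathbb T}\in\mathcal V(\mathbb T)$ is defined by $\langle Bu_{\mathbb T},v\rangle=\Phi(v)$ for all $v\in\mathcal V(\mathbb T)$. For $\Lambda\subset\mathcal F\times\Theta$, the family $\textsc{Refine}(\Lambda)=(\tilde{\mathcal T}_\nu)_{\nu\in\tilde F}$ has $\tilde F=\{\nu:\exists\lambda,\ (\nu,\lambda)\in\Lambda\}$, and $\tilde{\mathcal T}_\nu$ is the smallest conforming mesh $\ge\hat{\mathcal T}_0$ such that $\operatorname{span}\{\psi_\lambda:(\nu,\lambda)\in\Lambda\}\subseteq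 V(\tilde{\mathcal T}_\nu)$. **Statement.** Let $w\in\mathcal V(\mathbb T)$ and $\hat{\mathbf r}\in\ell_2(\mathcal F\times\Theta)$ satisfy $\|\mathbf r(w)-\hat{\mathbf r}\|_{\ell_2}\le\zeta\|\mathbf r(w)\|_{\ell_2}$ with $\zeta\in(0,\frac12)$. Let $\tilde\Lambda\subset\mathcal F\times\Theta$ satisfy $\|\hat{\mathbf r}|_{\tilde\Lambda}\|_{\ell_2}\ge\omega_0\|\hat{\mathbf r}\|_{\ell_2}$ with $\omega_0\in(0,1]$ and $(1+\omega_0)\zeta<\omega_0$. Let $\tilde{\mathbb T}=\textsc{Refine}(\tilde\Lambda)$ be a refinement of $\mathbb T$, that is, $F\subseteq\tilde F$ and $\tilde{\mathcal T}_\nu\ge\mathcal T_\nu$ for $\nu\in F$. Then for all frame bounds $c_\Psi,C_\Psi$, with $C_{B,\Psi}=C_\Psi^2C_B/(c_\Psi^2c_B)$, one has $C_{B,\Psi}\ge1$ and $$\|u-u_{\tilde{\mathbb T}}\|_B\le\Bigl(1-\frac{(\omega_0-(1+\omega_0)\zeta)^2}{C_{B,\Psi}}\Bigr)^{1/2}\|u-w\|_B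 .$$ The same estimate holds, without presupposing that $\Psi$ is a frame, when $c_\Psi,C_\Psi\in[0,\infty]$ are the best (largest lower, smallest upper) constants in the frame inequality, where $1/C_{B,\Psi}$ is read as $0$ if $c_\Psi=0$ or $C_\Psi=\infty$. -/

import Mathlib

open MeasureTheory Set
open scoped ENNReal NNReal Gradient

noncomputable section

namespace SGFEM

/-! ### Labelled triangles and newest vertex bisection -/

/-- Points of the plane, with the Euclidean norm. -/
abbrev Pt : Type := EuclideanSpace ℝ (Fin 2)

/-- A triangle with edge labels `(i, i, i-1)`: the edge `{b₁, b₂}` carries the lowest label and is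
the next one to be bisected; `apex` is the opposite vertex. -/
@[ext]
structure Tri where
  apex : Pt
  b₁ : Pt
  b₂ : Pt

namespace Tri

/-- The three vertices. -/
def verts (K : Tri) : Set Pt := {K.apex, K.b₁, K.b₂}

/-- End points of the edge with the lowest label. -/
def base (K : Tri) : Set Pt := {K.b₁, K.b₂}

/-- The closed triangle. -/
def hull (K : Tri) : Set Pt := convexHull ℝ K.verts

/-- The three vertices are not collinear. -/
def Nondegenerate (K : Tri) : Prop := AffineIndependent ℝ ![K.apex, K.b₁, K.b₂]

/-- The two triangles obtained by bisecting the edge with the lowest label. The edges opposite the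
newly added vertex are the next ones to be bisected. -/
def children (K : Tri) : Set Tri :=
  {⟨midpoint ℝ K.b₁ K.b₂, K.apex, K.b₁⟩, ⟨midpoint ℝ K.b₁ K.b₂, K.apex, K.b₂⟩}

end Tri

/-- Two different triangles meet in the convex hull of their common vertices: a common edge, a
common vertex, or not at all. -/
def Conforming (𝒯 : Set Tri) : Prop :=
  ∀ K ∈ 𝒯, ∀ K' ∈ 𝒯, K ≠ K' →
    K.verts ≠ K'.verts ∧ K.hull ∩ K'.hull = convexHull ℝ (K.verts ∩ K'.verts)

/-- One bisection step: a single element is replaced by its two children. -/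
def BisectStep (𝒯 𝒯' : Set Tri) : Prop :=
  ∃ K ∈ 𝒯, 𝒯' = (𝒯 \ {K}) ∪ K.children

/-- `MeshLE 𝒯 𝒯'` is `𝒯' ≥ 𝒯`: the mesh `𝒯'` is generated from `𝒯` by finitely many steps of newest
vertex bisection. -/
def MeshLE (𝒯 𝒯' : Set Tri) : Prop := Relation.ReflTransGen BisectStep 𝒯 𝒯'

/-- One pass of newest vertex bisection over the full mesh. -/
def bisectAll (𝒯 : Set Tri) : Set Tri := ⋃ K ∈ 𝒯, K.children

/-- A conforming coarsest triangulation with an admissible edge labelling: an edge that carries the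
lowest label in one triangle carries the lowest label in every triangle containing it. -/
structure InitialTriangulation where
  cells : Set Tri
  finite : cells.Finite
  nondegenerate : ∀ K ∈ cells, K.Nondegenerate
  conforming : Conforming cells
  admissible : ∀ K ∈ cells, ∀ K' ∈ cells, K.base ⊆ K'.verts → K.base = K'.base

/-- The polygonal domain `D` that is triangulated. -/
def InitialTriangulation.domain (T₀ : InitialTriangulation) : Set Pt :=
  interior (⋃ K ∈ T₀.cells, K.hull)

/-- The hierarchy of uniform refinements, two full passes of bisection per level. -/
def InitialTriangulation.uniform (T₀ : InitialTriangulation) (j : ℕ) : Set Tri :=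
  bisectAll^[2 * j] T₀.cells

lemma InitialTriangulation.isBounded_domain (T₀ : InitialTriangulation) :
    Bornology.IsBounded T₀.domain := by
  refine Bornology.IsBounded.subset ?_ interior_subset
  refine (Bornology.isBounded_biUnion T₀.finite).2 fun K _ => ?_
  refine isBounded_convexHull.2 (Set.Finite.isBounded ?_)
  simp [Tri.verts]

/-! ### The Sobolev space of functions vanishing on the boundary -/

/-- The pairs `(φ, ∇φ)` with `φ` smooth and compactly supported in `D`, as classes in `L₂`. -/
def testGraph (D : Set Pt) :
    Submodule ℝ (Lp ℝ 2 (volume.restrict D) × Lp Pt 2 (volume.restrict D)) where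
  carrier := {p | ∃ φ : Pt → ℝ, ContDiff ℝ (⊤ : ℕ∞) φ ∧ HasCompactSupport φ ∧ tsupport φ ⊆ D ∧
    p.1 =ᵐ[volume.restrict D] φ ∧ p.2 =ᵐ[volume.restrict D] ∇ φ}
  zero_mem' := by
    refine ⟨0, contDiff_const, HasCompactSupport.zero, by simp, ?_, ?_⟩
    · exact Lp.coeFn_zero _ _ _
    · filter_upwards [Lp.coeFn_zero Pt 2 (volume.restrict D)] with x hx
      have : (∇ (0 : Pt → ℝ)) x = 0 := by
        have := gradient_fun_const (F := Pt) x (0 : ℝ)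
        exact this
      rw [this]; exact hx
  add_mem' := by
    rintro p q ⟨φ, h1, h2, h3, h4, h5⟩ ⟨χ, k1, k2, k3, k4, k5⟩
    refine ⟨φ + χ, h1.add k1, h2.add k2,
      (tsupport_add φ χ).trans (union_subset h3 k3), ?_, ?_⟩
    · exact (Lp.coeFn_add p.1 q.1).trans (h4.add k4)
    · filter_upwards [Lp.coeFn_add p.2 q.2, h5, k5] with x hx hx1 hx2
      have e : (∇ (φ + χ)) x = (∇ φ) x + (∇ χ) x := by
        unfold gradient
        rw [fderiv_add (h1.differentiable (by simp) x) (k1.differentiable (by simp) x), map_add]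
      rw [e, ← hx1, ← hx2]; exact hx
  smul_mem' := by
    rintro c p ⟨φ, h1, h2, h3, h4, h5⟩
    refine ⟨c • φ, contDiff_const.smul h1, h2.smul_left,
      (tsupport_smul_subset_right (fun _ => c) φ).trans h3, ?_, ?_⟩
    · exact (Lp.coeFn_smul c p.1).trans (h4.const_smul c)
    · filter_upwards [Lp.coeFn_smul c p.2, h5] with x hx hx1
      have e : (∇ (c • φ)) x = c • (∇ φ) x := by
        unfold gradient
        rw [fderiv_const_smul (h1.differentiable (by simp) x), map_smul]
      rw [e, ← hx1]; exact hx

/-- The pairs `(v, ∇v)` with `v ∈ H¹₀(D)`: the closure of the smooth compactly supported functions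
in the graph norm. -/
def sobolevGraph (D : Set Pt) :
    Submodule ℝ (Lp ℝ 2 (volume.restrict D) × Lp Pt 2 (volume.restrict D)) :=
  (testGraph D).topologicalClosure

/-- Poincaré's inequality on a bounded set. -/
lemma poincare {D : Set Pt} (hD : Bornology.IsBounded D) :
    ∃ C : ℝ, ∀ p ∈ sobolevGraph D, ‖p.1‖ ≤ C * ‖p.2‖ := by
  have hvol : volume D ≠ ∞ := hD.measure_lt_top.ne
  have hconj : NNReal.HolderConjugate ((Module.finrank ℝ Pt : ℕ) : ℝ≥0) 2 := by
    rw [finrank_euclideanSpace_fin, NNReal.holderConjugate_iff]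
    refine ⟨by norm_num, ?_⟩
    rw [← NNReal.coe_inj]
    push_cast
    norm_num
  set c₀ : ℝ≥0∞ := (eLpNormLESNormFDerivOneConst (volume : Measure Pt) 2 : ℝ≥0∞) *
    (volume D) ^ ((1 : ℝ) / 2) with hc₀
  have hc₀top : c₀ ≠ ∞ :=
    ENNReal.mul_ne_top ENNReal.coe_ne_top (ENNReal.rpow_ne_top_of_nonneg (by norm_num) hvol)
  refine ⟨c₀.toReal, ?_⟩
  have hclosed : IsClosed {p : Lp ℝ 2 (volume.restrict D) × Lp Pt 2 (volume.restrict D) |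
      ‖p.1‖ ≤ c₀.toReal * ‖p.2‖} :=
    isClosed_le continuous_fst.norm (continuous_const.mul continuous_snd.norm)
  intro p hp
  have hp' : p ∈ closure (testGraph D :
      Set (Lp ℝ 2 (volume.restrict D) × Lp Pt 2 (volume.restrict D))) := hp
  refine closure_minimal ?_ hclosed hp'
  rintro q ⟨φ, h1, h2, h3, h4, h5⟩
  have hsup : Function.support (fderiv ℝ φ) ⊆ D :=
    (subset_tsupport _).trans ((tsupport_fderiv_subset ℝ).trans h3)
  have hsm : AEStronglyMeasurable (fderiv ℝ φ) (volume.restrict D) :=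
    (h1.continuous_fderiv (by simp)).aestronglyMeasurable
  have e1 : eLpNorm φ 2 (volume.restrict D) ≤ c₀ * eLpNorm (fderiv ℝ φ) 2 (volume.restrict D) := by
    calc eLpNorm φ 2 (volume.restrict D) ≤ eLpNorm φ 2 volume := eLpNorm_restrict_le _ _ _ _
      _ ≤ eLpNormLESNormFDerivOneConst (volume : Measure Pt) 2 * eLpNorm (fderiv ℝ φ) 1 volume :=
        eLpNorm_le_eLpNorm_fderiv_one volume (h1.of_le (by simp)) h2 hconj
      _ = eLpNormLESNormFDerivOneConst (volume : Measure Pt) 2 *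
          eLpNorm (fderiv ℝ φ) 1 (volume.restrict D) := by
        rw [eLpNorm_one_eq_lintegral_enorm, eLpNorm_one_eq_lintegral_enorm,
          setLIntegral_eq_of_support_subset]
        intro x hx
        refine hsup fun h0 => hx ?_
        show ‖fderiv ℝ φ x‖ₑ = 0
        rw [← ofReal_norm, h0, norm_zero, ENNReal.ofReal_zero]
      _ ≤ eLpNormLESNormFDerivOneConst (volume : Measure Pt) 2 *
          (eLpNorm (fderiv ℝ φ) 2 (volume.restrict D) * (volume D) ^ ((1 : ℝ) / 2)) := by
        gcongr
        have := eLpNorm_le_eLpNorm_mul_rpow_measure_univ (p := 1) (q := 2) (by norm_num) hsm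
        refine this.trans (le_of_eq ?_)
        rw [Measure.restrict_apply_univ]
        norm_num
      _ = _ := by rw [hc₀]; ring
  have e2 : eLpNorm (fderiv ℝ φ) 2 (volume.restrict D) = eLpNorm q.2 2 (volume.restrict D) := by
    rw [eLpNorm_congr_ae h5]
    refine eLpNorm_congr_norm_ae (Filter.Eventually.of_forall fun x => ?_)
    simp [gradient]
  have e3 : eLpNorm q.1 2 (volume.restrict D) = eLpNorm φ 2 (volume.restrict D) :=
    eLpNorm_congr_ae h4
  show ‖q.1‖ ≤ c₀.toReal * ‖q.2‖
  rw [Lp.norm_def, Lp.norm_def, ← ENNReal.toReal_mul]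
  refine ENNReal.toReal_mono (ENNReal.mul_ne_top hc₀top (Lp.eLpNorm_ne_top _)) ?_
  rw [e3, ← e2]
  exact e1

/-- `V = H¹₀(D)` for the domain `D` of the coarsest triangulation. -/
def V (T₀ : InitialTriangulation) : Type := sobolevGraph T₀.domain

namespace V

variable {T₀ : InitialTriangulation}

instance : AddCommGroup (V T₀) := inferInstanceAs (AddCommGroup (sobolevGraph T₀.domain))
instance : Module ℝ (V T₀) := inferInstanceAs (Module ℝ (sobolevGraph T₀.domain))

/-- The function `v` as an element of `L₂(D)`. -/
def fn (T₀ : InitialTriangulation) : V T₀ →ₗ[ℝ] Lp ℝ 2 (volume.restrict T₀.domain) :=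
  (LinearMap.fst ℝ _ _).comp (sobolevGraph T₀.domain).subtype

/-- The weak gradient `∇v` as an element of `L₂(D; ℝ²)`. -/
def grad (T₀ : InitialTriangulation) : V T₀ →ₗ[ℝ] Lp Pt 2 (volume.restrict T₀.domain) :=
  (LinearMap.snd ℝ _ _).comp (sobolevGraph T₀.domain).subtype

lemma grad_injective : Function.Injective (grad T₀) := by
  rw [← LinearMap.ker_eq_bot, LinearMap.ker_eq_bot']
  rintro ⟨p, hp⟩ h
  obtain ⟨C, hC⟩ := poincare T₀.isBounded_domain
  have h2 : p.2 = 0 := h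
  have h1 : p.1 = 0 := by
    have := hC p hp
    rw [h2, norm_zero, mul_zero] at this
    exact norm_le_zero_iff.1 this
  exact Subtype.ext (Prod.ext h1 h2)

/-- The norm on `V` is `‖v‖ = ‖∇v‖` in `L₂`. -/
instance : NormedAddCommGroup (V T₀) :=
  NormedAddCommGroup.induced (V T₀) (Lp Pt 2 (volume.restrict T₀.domain)) (grad T₀) grad_injective

instance : InnerProductSpace ℝ (V T₀) where
  toNormedSpace := NormedSpace.induced ℝ (V T₀) (Lp Pt 2 (volume.restrict T₀.domain)) (grad T₀)
  inner v w := inner ℝ (grad T₀ v) (grad T₀ w)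
  norm_sq_eq_re_inner v := norm_sq_eq_re_inner (𝕜 := ℝ) (grad T₀ v)
  conj_inner_symm v w := inner_conj_symm (𝕜 := ℝ) (grad T₀ v) (grad T₀ w)
  add_left u v w := by rw [map_add, inner_add_left]
  smul_left u v c := by rw [map_smul, inner_smul_left]

end V

/-! ### Finite element spaces and the frame of hat functions -/

/-- `V(𝒯)`: the elements of `V` that are affine on each element of `𝒯`. -/
def feSpace (T₀ : InitialTriangulation) (𝒯 : Set Tri) : Submodule ℝ (V T₀) where
  carrier := {v | ∀ K ∈ 𝒯, ∃ l : Pt →ᵃ[ℝ] ℝ,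
    ∀ᵐ x ∂(volume.restrict T₀.domain), x ∈ K.hull → V.fn T₀ v x = l x}
  zero_mem' := by
    intro K _
    refine ⟨0, ?_⟩
    rw [map_zero]
    filter_upwards [Lp.coeFn_zero ℝ 2 (volume.restrict T₀.domain)] with x hx _
    simpa using hx
  add_mem' := by
    intro v w hv hw K hK
    obtain ⟨l, hl⟩ := hv K hK
    obtain ⟨l', hl'⟩ := hw K hK
    refine ⟨l + l', ?_⟩
    rw [map_add]
    filter_upwards [Lp.coeFn_add (V.fn T₀ v) (V.fn T₀ w), hl, hl'] with x hx h1 h2 hxK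
    rw [hx, Pi.add_apply, h1 hxK, h2 hxK]; rfl
  smul_mem' := by
    intro c v hv K hK
    obtain ⟨l, hl⟩ := hv K hK
    refine ⟨c • l, ?_⟩
    rw [map_smul]
    filter_upwards [Lp.coeFn_smul c (V.fn T₀ v), hl] with x hx h1 hxK
    rw [hx, Pi.smul_apply, h1 hxK]; rfl

/-- `ψ` is a hat function on `𝒯`, normalized in `V`: for an interior node `z` and some `c > 0`, it is
affine on each element, with value `c` at `z` and `0` at all other nodes. -/
def IsNormalizedHat (T₀ : InitialTriangulation) (𝒯 : Set Tri) (ψ : V T₀) : Prop :=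
  ‖ψ‖ = 1 ∧ ∃ z ∈ T₀.domain, (∃ K ∈ 𝒯, z ∈ K.verts) ∧ ∃ c : ℝ, 0 < c ∧
    ∀ K ∈ 𝒯, ∃ l : Pt →ᵃ[ℝ] ℝ, (∀ p ∈ K.verts, (p = z → l p = c) ∧ (p ≠ z → l p = 0)) ∧
      ∀ᵐ x ∂(volume.restrict T₀.domain), x ∈ K.hull → V.fn T₀ ψ x = l x

/-- The index set `Θ`: pairs of a level `j` and a normalized hat function on the `j`-th uniform
refinement. -/
def Theta (T₀ : InitialTriangulation) : Type :=
  Σ j : ℕ, {ψ : V T₀ // IsNormalizedHat T₀ (T₀.uniform j) ψ}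

/-- The family `Ψ = (ψ_lam)` of normalized hat functions on all levels, indexed by `Θ`. -/
def frame (T₀ : InitialTriangulation) (lam : Theta T₀) : V T₀ := lam.2.1

/-- `∑_lam |⟨ξ, ψ_lam⟩|²` for `ξ ∈ V'`. -/
def frameSum (T₀ : InitialTriangulation) (ξ : StrongDual ℝ (V T₀)) : ℝ≥0∞ :=
  ∑' lam : Theta T₀, ‖ξ (frame T₀ lam)‖ₑ ^ 2

/-- `c` and `C` are frame bounds: `c² ‖ξ‖² ≤ ∑_lam |⟨ξ, ψ_lam⟩|² ≤ C² ‖ξ‖²` for all `ξ ∈ V'`. -/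
def IsFrameBounds (T₀ : InitialTriangulation) (c C : ℝ) : Prop :=
  ∀ ξ : StrongDual ℝ (V T₀),
    ENNReal.ofReal (c ^ 2 * ‖ξ‖ ^ 2) ≤ frameSum T₀ ξ ∧
      frameSum T₀ ξ ≤ ENNReal.ofReal (C ^ 2 * ‖ξ‖ ^ 2)

/-- The square of the best (largest) lower frame bound. -/
def lowerFrameBoundSq (T₀ : InitialTriangulation) : ℝ≥0∞ :=
  sSup {k | ∀ ξ : StrongDual ℝ (V T₀), k * ‖ξ‖ₑ ^ 2 ≤ frameSum T₀ ξ}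

/-- The square of the best (smallest) upper frame bound. -/
def upperFrameBoundSq (T₀ : InitialTriangulation) : ℝ≥0∞ :=
  sInf {k | ∀ ξ : StrongDual ℝ (V T₀), frameSum T₀ ξ ≤ k * ‖ξ‖ₑ ^ 2}

/-! ### Parameters and Legendre polynomials -/

/-- The parameter domain `Y = [-1,1]^M`. -/
abbrev Y (M : Type*) : Type _ := M → Icc (-1 : ℝ) 1

/-- The uniform probability measure on `[-1,1]`. -/
def sigmaOne : Measure (Icc (-1 : ℝ) 1) := (2 : ℝ≥0∞)⁻¹ • Measure.comap Subtype.val (volume : Measure ℝ)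

instance : IsProbabilityMeasure sigmaOne := ⟨by
  have h : Measure.comap (Subtype.val : Icc (-1 : ℝ) 1 → ℝ) volume univ = 2 := by
    rw [(MeasurableEmbedding.subtype_coe measurableSet_Icc).comap_apply, image_univ,
      Subtype.range_coe, Real.volume_Icc]
    norm_num
  rw [sigmaOne, Measure.smul_apply, h, smul_eq_mul]
  exact ENNReal.inv_mul_cancel (by norm_num) (by norm_num)⟩

/-- The product of the uniform measures on `Y`. -/
def sigma (M : Type*) : Measure (Y M) := Measure.infinitePi fun _ : M => sigmaOne

instance (M : Type*) : IsProbabilityMeasure (sigma M) :=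
  inferInstanceAs (IsProbabilityMeasure (Measure.infinitePi fun _ : M => sigmaOne))

/-- The Legendre polynomials (by Rodrigues' formula), normalized to be orthonormal with respect to
the uniform probability measure on `[-1,1]`. -/
def legendre (k : ℕ) (t : ℝ) : ℝ :=
  √(2 * k + 1) * ((2 ^ k * (k.factorial : ℝ))⁻¹ *
    (Polynomial.derivative^[k] ((Polynomial.X ^ 2 - 1 : Polynomial ℝ) ^ k)).eval t)

/-- The product Legendre polynomial `L_ν`, for a finitely supported multi-index `ν`. -/
def legendreProd {M : Type*} (ν : M →₀ ℕ) (y : Y M) : ℝ := ν.prod fun μ k => legendre k (y μ)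

/-! ### The parametric problem -/

/-- `𝒱 = L₂(Y, V, σ)`. -/
abbrev VV (T₀ : InitialTriangulation) (M : Type*) : Type _ := Lp (V T₀) 2 (sigma M)

/-- The coefficient `a(y) = θ₀ + ∑_μ y_μ θ_μ`. -/
def coeff {M : Type*} (θ₀ : Pt → ℝ) (θ : M → Pt → ℝ) (y : Y M) (x : Pt) : ℝ :=
  θ₀ x + ∑' μ, (y μ : ℝ) * θ μ x

/-- `c_B`, the essential infimum of `θ₀ - ∑_μ |θ_μ|` on `D`. -/
def cB (T₀ : InitialTriangulation) {M : Type*} (θ₀ : Pt → ℝ) (θ : M → Pt → ℝ) : ℝ :=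
  essInf (fun x => θ₀ x - ∑' μ, |θ μ x|) (volume.restrict T₀.domain)

/-- `C_B = sup_{y ∈ Y} ‖a(y)‖_{L_∞(D)}`. -/
def CB (T₀ : InitialTriangulation) {M : Type*} (θ₀ : Pt → ℝ) (θ : M → Pt → ℝ) : ℝ :=
  ⨆ y : Y M, (eLpNorm (coeff θ₀ θ y) ∞ (volume.restrict T₀.domain)).toReal

/-- Uniform ellipticity: the sum `∑_μ |θ_μ|` is finite almost everywhere and `c_B > 0`. -/
def UniformlyElliptic (T₀ : InitialTriangulation) {M : Type*} (θ₀ : Pt → ℝ) (θ : M → Pt → ℝ) :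
    Prop :=
  (∀ᵐ x ∂(volume.restrict T₀.domain), Summable fun μ => |θ μ x|) ∧ 0 < cB T₀ θ₀ θ

/-- `∫_D a(y) ∇v · ∇w dx` for `v, w ∈ V`. -/
def stiffness (T₀ : InitialTriangulation) {M : Type*} (θ₀ : Pt → ℝ) (θ : M → Pt → ℝ) (y : Y M)
    (v w : V T₀) : ℝ :=
  ∫ x in T₀.domain, coeff θ₀ θ y x * inner ℝ (V.grad T₀ v x) (V.grad T₀ w x)

/-- `f(v) = ∫_D f v dx` for `v ∈ V`. -/
def load (T₀ : InitialTriangulation) (f : Pt → ℝ) (v : V T₀) : ℝ :=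
  ∫ x in T₀.domain, f x * V.fn T₀ v x

/-- `⟨B v, w⟩` for `v, w ∈ 𝒱`. -/
def formB (T₀ : InitialTriangulation) {M : Type*} (θ₀ : Pt → ℝ) (θ : M → Pt → ℝ) (v w : VV T₀ M) :
    ℝ :=
  ∫ y, stiffness T₀ θ₀ θ y (v y) (w y) ∂(sigma M)

/-- `⟨Φ, w⟩ = ∫_Y f(w(y)) dσ(y)` for `w ∈ 𝒱`. -/
def loadPhi (T₀ : InitialTriangulation) {M : Type*} (f : Pt → ℝ) (w : VV T₀ M) : ℝ :=
  ∫ y, load T₀ f (w y) ∂(sigma M)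

/-- The energy norm `‖v‖_B`. -/
def normB (T₀ : InitialTriangulation) {M : Type*} (θ₀ : Pt → ℝ) (θ : M → Pt → ℝ) (v : VV T₀ M) :
    ℝ :=
  √(formB T₀ θ₀ θ v v)

/-- The frame residual coefficients `𝐫(w)_{ν,lam} = ⟨[B w - f]_ν, ψ_lam⟩`, where
`[ξ]_ν = ∫_Y ξ(y) L_ν(y) dσ(y)`. -/
def residual (T₀ : InitialTriangulation) {M : Type*} (θ₀ : Pt → ℝ) (θ : M → Pt → ℝ) (f : Pt → ℝ)
    (w : VV T₀ M) (i : (M →₀ ℕ) × Theta T₀) : ℝ :=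
  ∫ y, (stiffness T₀ θ₀ θ y (w y) (frame T₀ i.2) - load T₀ f (frame T₀ i.2)) *
    legendreProd i.1 y ∂(sigma M)

/-- The `ℓ₂` norm of a family of real numbers, `∞` if the family is not square summable. -/
def ellTwo {ι : Type*} (r : ι → ℝ) : ℝ≥0∞ := (∑' i, ‖r i‖ₑ ^ 2) ^ ((1 : ℝ) / 2)

/-- The constant `C_Ψ² C_B / (c_Ψ² c_B)` for the best frame bounds `c_Ψ`, `C_Ψ`. -/
def saturationConst (T₀ : InitialTriangulation) {M : Type*} (θ₀ : Pt → ℝ) (θ : M → Pt → ℝ) :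
    ℝ≥0∞ :=
  (upperFrameBoundSq T₀ * ENNReal.ofReal (CB T₀ θ₀ θ)) /
    (lowerFrameBoundSq T₀ * ENNReal.ofReal (cB T₀ θ₀ θ))

/-! ### Families of meshes, refinement and Galerkin solutions -/

/-- A family `(𝒯_ν)_{ν ∈ F}` of conforming newest vertex bisection meshes with a finite set `F` of
multi-indices; the values of `mesh` outside `F` are irrelevant. -/
structure MeshFamily (T₀ : InitialTriangulation) (M : Type*) where
  F : Finset (M →₀ ℕ)
  mesh : (M →₀ ℕ) → Set Tri
  le : ∀ ν ∈ F, MeshLE T₀.cells (mesh ν)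
  conforming : ∀ ν ∈ F, Conforming (mesh ν)

namespace MeshFamily

variable {T₀ : InitialTriangulation} {M : Type*}

/-- `𝒱(𝕋)`: the sums `∑_{ν ∈ F} v_ν L_ν` with `v_ν ∈ V(𝒯_ν)`. -/
def space (𝕋 : MeshFamily T₀ M) : Set (VV T₀ M) :=
  {v | ∃ c : (M →₀ ℕ) → V T₀, (∀ ν ∈ 𝕋.F, c ν ∈ feSpace T₀ (𝕋.mesh ν)) ∧
    v =ᵐ[sigma M] fun y => ∑ ν ∈ 𝕋.F, legendreProd ν y • c ν}

/-- `𝕋'` is a refinement of `𝕋`. -/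
def RefinedBy (𝕋 𝕋' : MeshFamily T₀ M) : Prop :=
  𝕋.F ⊆ 𝕋'.F ∧ ∀ ν ∈ 𝕋.F, MeshLE (𝕋.mesh ν) (𝕋'.mesh ν)

/-- `𝕋 = Refine(Λ)`: with `F = {ν | ∃ lam, (ν, lam) ∈ Λ}`, for each `ν ∈ F` the mesh `𝒯_ν` is the
smallest conforming mesh for which `V(𝒯_ν)` contains the span of all `ψ_lam` with `(ν, lam) ∈ Λ`. -/
def IsRefine (𝕋 : MeshFamily T₀ M) (Λ : Set ((M →₀ ℕ) × Theta T₀)) : Prop :=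
  (𝕋.F : Set (M →₀ ℕ)) = Prod.fst '' Λ ∧
  ∀ ν ∈ 𝕋.F,
    Submodule.span ℝ (frame T₀ '' {lam | (ν, lam) ∈ Λ}) ≤ feSpace T₀ (𝕋.mesh ν) ∧
    ∀ 𝒯 : Set Tri, MeshLE T₀.cells 𝒯 → Conforming 𝒯 →
      Submodule.span ℝ (frame T₀ '' {lam | (ν, lam) ∈ Λ}) ≤ feSpace T₀ 𝒯 →
        MeshLE (𝕋.mesh ν) 𝒯

/-- `v` is the Galerkin solution in `𝒱(𝕋)`. -/
def IsGalerkinSolution (𝕋 : MeshFamily T₀ M) (θ₀ : Pt → ℝ) (θ : M → Pt → ℝ) (f : Pt → ℝ)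
    (v : VV T₀ M) : Prop :=
  v ∈ 𝕋.space ∧ ∀ z ∈ 𝕋.space, formB T₀ θ₀ θ v z = loadPhi T₀ f z

end MeshFamily

end SGFEM

end

/-!
# Error reduction for adaptive stochastic Galerkin methods steered by frame coefficients

Write `T_{ν,lam} = L_ν ψ_lam` and `e = u - w`. The residual coefficients are
`𝐫(w)_{ν,lam} = ⟨B (w - u), T_{ν,lam}⟩` (`residual_eq`), so the family `(T_{ν,lam})` turns the dual
norm of `B z` into an `ℓ₂` norm, in two ways.

* For any finite set of indices, testing `B z` against `∑ a_i T_i` with `a_i = ⟨B z, T_i⟩` and using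
  the Cauchy-Schwarz inequality gives `∑ a_i² ≤ C_Ψ² C_B ‖z‖_B²` (`sum_formB_sq_le`). This needs
  that the synthesis operator of `(T_i)` is bounded by `C_Ψ`, which follows from the orthonormality
  of the `L_ν` and, by duality, from the upper frame bound (`norm_sq_sum_tens_synthesis_le`).
* Conversely, `c_Ψ² c_B ‖z‖_B² ≤ ∑ ⟨B z, T_i⟩²` over all indices (`formB_le_ellTwo_sq`). The lower
  frame bound is applied to each component `[B z]_ν`; that the components determine the full norm in
  `𝒱'` is the completeness of the product Legendre polynomials in `L₂(Y, σ)`, which comes from the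
  Stone-Weierstrass theorem (`dense_span_legendreLp`) and carries over to `L₂(Y, V, σ)`
  (`denseRange_sumTens`).

On the index set `Λ`, the functions `T_i` belong to the refined space, so that there `u` can be
replaced by the Galerkin solution `u'`. With the bulk criterion, transferred from the approximate to
the exact residual (`bulk_of_approx_bulk`), and with `κ = ω₀ - (1 + ω₀) ζ`, this gives
`κ² c_Ψ² c_B ‖e‖_B² ≤ κ² ‖𝐫(w)‖² ≤ ‖𝐫(w)|_Λ‖² ≤ C_Ψ² C_B ‖w - u'‖_B²`.
As `w` lies in the refined space too, Galerkin orthogonality reads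
`‖e‖_B² = ‖u - u'‖_B² + ‖w - u'‖_B²` (`formB_sub_eq_add`), and the estimate follows.

If finite and positive, the best frame constants are themselves frame bounds
(`isFrameBounds_best`). Otherwise the factor in the estimate is `1`, and Galerkin orthogonality
alone suffices.

That all forms make sense rests on the joint continuity of `(y, v, w) ↦ ∫_D a(y) ∇v · ∇w`
(`continuous_stiffness`), which makes the integrands in `y` measurable.
-/

noncomputable section

namespace SGFEM

/-! ### Legendre polynomials in one variable -/

section LegendreOne

open Polynomial

/-- The polynomial `D^k (X² - 1)^k` of Rodrigues' formula. -/
def rodrigues (k : ℕ) : ℝ[X] := derivative^[k] ((X ^ 2 - 1) ^ k)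

/-- The normalized Legendre polynomial as a formal polynomial. -/
def legendrePoly (k : ℕ) : ℝ[X] :=
  C (√(2 * k + 1) * (2 ^ k * (k.factorial : ℝ))⁻¹) * rodrigues k

lemma eval_legendrePoly (k : ℕ) (t : ℝ) : (legendrePoly k).eval t = legendre k t := by
  simp [legendrePoly, legendre, rodrigues, mul_assoc]

lemma continuous_legendre (k : ℕ) : Continuous (legendre k) := by
  simpa only [eval_legendrePoly] using (legendrePoly k).continuous

lemma legendre_zero (t : ℝ) : legendre 0 t = 1 := by
  simp [legendre]

lemma monic_X_sq_sub_one_pow (k : ℕ) : ((X ^ 2 - 1 : ℝ[X]) ^ k).Monic := by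
  have : (X ^ 2 - C (1 : ℝ)).Monic := monic_X_pow_sub_C 1 two_ne_zero
  rw [C_1] at this
  exact this.pow k

lemma natDegree_X_sq_sub_one_pow (k : ℕ) : ((X ^ 2 - 1 : ℝ[X]) ^ k).natDegree = 2 * k := by
  have : (X ^ 2 - C (1 : ℝ)).natDegree = 2 := natDegree_X_pow_sub_C
  rw [C_1] at this
  rw [natDegree_pow, this, mul_comm]

lemma degree_legendrePoly (k : ℕ) : (legendrePoly k).degree = k := by
  have hc : √(2 * k + 1) * (2 ^ k * (k.factorial : ℝ))⁻¹ ≠ 0 := by positivity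
  rw [legendrePoly, degree_C_mul hc]
  refine degree_eq_of_le_of_coeff_ne_zero ?_ ?_
  · refine degree_le_natDegree.trans (Nat.cast_le.2 ?_)
    refine (natDegree_iterate_derivative _ _).trans ?_
    rw [natDegree_X_sq_sub_one_pow]; omega
  · have h1 : ((X ^ 2 - 1 : ℝ[X]) ^ k).coeff (k + k) = 1 := by
      have := (monic_X_sq_sub_one_pow k).coeff_natDegree
      rwa [natDegree_X_sq_sub_one_pow, two_mul] at this
    rw [rodrigues, coeff_iterate_derivative, h1, nsmul_eq_mul, mul_one, Nat.cast_ne_zero]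
    exact (Nat.descFactorial_pos.2 (by omega)).ne'

lemma span_legendrePoly : Submodule.span ℝ (range legendrePoly) = ⊤ := by
  let S : Polynomial.Sequence ℝ := ⟨legendrePoly, degree_legendrePoly⟩
  exact S.span fun i => (leadingCoeff_ne_zero.2 (S.ne_zero i)).isUnit

lemma intervalIntegrable_eval (p : ℝ[X]) (a b : ℝ) :
    IntervalIntegrable (fun x => p.eval x) volume a b :=
  p.continuous.intervalIntegrable a b

lemma integral_derivative_eval (p : ℝ[X]) :
    ∫ x in (-1 : ℝ)..1, (derivative p).eval x = p.eval 1 - p.eval (-1) :=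
  intervalIntegral.integral_eq_sub_of_hasDerivAt (fun x _ => p.hasDerivAt x)
    (intervalIntegrable_eval _ _ _)

/-- Integration by parts without boundary terms. -/
lemma integral_derivative_mul_eval {p : ℝ[X]} (h1 : p.eval 1 = 0) (h2 : p.eval (-1) = 0)
    (q : ℝ[X]) : ∫ x in (-1 : ℝ)..1, (derivative p * q).eval x =
      -∫ x in (-1 : ℝ)..1, (p * derivative q).eval x := by
  have h := integral_derivative_eval (p * q)
  rw [derivative_mul] at h
  simp only [eval_add] at h
  rw [intervalIntegral.integral_add (intervalIntegrable_eval _ _ _)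
    (intervalIntegrable_eval _ _ _)] at h
  simp only [eval_mul, h1, h2, zero_mul, sub_zero] at h ⊢
  linarith

/-- All derivatives of `(X² - 1)^n` of order below `n` vanish at `±1`. -/
lemma eval_iterate_derivative_eq_zero {k n : ℕ} (hk : k < n) {t : ℝ} (ht : t ^ 2 = 1) :
    (derivative^[k] ((X ^ 2 - 1 : ℝ[X]) ^ n)).eval t = 0 := by
  obtain ⟨q, hq⟩ := pow_sub_dvd_iterate_derivative_pow (X ^ 2 - 1 : ℝ[X]) n k
  rw [hq, eval_mul, eval_pow]
  simp [ht, show n - k ≠ 0 by omega]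

lemma integral_iterate_derivative_mul_eval {k n : ℕ} (hk : k ≤ n) (q : ℝ[X]) :
    ∫ x in (-1 : ℝ)..1, (derivative^[k] ((X ^ 2 - 1 : ℝ[X]) ^ n) * q).eval x =
      (-1) ^ k * ∫ x in (-1 : ℝ)..1, ((X ^ 2 - 1 : ℝ[X]) ^ n * derivative^[k] q).eval x := by
  induction k generalizing q with
  | zero => simp
  | succ k ih =>
    rw [Function.iterate_succ_apply', integral_derivative_mul_eval
      (eval_iterate_derivative_eq_zero (by omega) (by norm_num))
      (eval_iterate_derivative_eq_zero (by omega) (by norm_num)), ih (by omega),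
      ← Function.iterate_succ_apply]
    ring

/-- After `n` integrations by parts, the factor of lower degree is differentiated to `0`. -/
lemma integral_rodrigues_mul_of_lt {m n : ℕ} (h : m < n) :
    ∫ x in (-1 : ℝ)..1, (rodrigues n * rodrigues m).eval x = 0 := by
  rw [rodrigues, integral_iterate_derivative_mul_eval le_rfl, rodrigues,
    ← Function.iterate_add_apply, iterate_derivative_eq_zero]
  · simp
  · rw [natDegree_X_sq_sub_one_pow]; omega

lemma integral_X_sq_sub_one_pow (n : ℕ) :
    ∫ x in (-1 : ℝ)..1, ((X ^ 2 - 1 : ℝ[X]) ^ n).eval x =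
      (-1) ^ n * 2 ^ (2 * n + 1) * (n.factorial : ℝ) ^ 2 / ((2 * n + 1).factorial : ℝ) := by
  induction n with
  | zero => norm_num
  | succ n ih =>
    -- the recursion comes from the derivative of `X (X² - 1)^(n+1)`
    have h := integral_derivative_eval (X * (X ^ 2 - 1) ^ (n + 1))
    have e : derivative (X * (X ^ 2 - 1 : ℝ[X]) ^ (n + 1)) =
        C (2 * n + 3 : ℝ) * (X ^ 2 - 1) ^ (n + 1) + C (2 * n + 2 : ℝ) * (X ^ 2 - 1) ^ n := by
      simp only [derivative_mul, derivative_X, derivative_pow, derivative_sub, derivative_one,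
        map_add, map_mul, C_ofNat, map_natCast]
      push_cast
      ring
    rw [e] at h
    simp only [eval_add, eval_C_mul] at h
    rw [intervalIntegral.integral_add ((intervalIntegrable_eval _ _ _).const_mul _)
      ((intervalIntegrable_eval _ _ _).const_mul _), intervalIntegral.integral_const_mul,
      intervalIntegral.integral_const_mul, ih] at h
    have h0 : (X * (X ^ 2 - 1 : ℝ[X]) ^ (n + 1)).eval 1 -
        (X * (X ^ 2 - 1 : ℝ[X]) ^ (n + 1)).eval (-1) = 0 := by simp
    rw [h0] at h
    have hf : ((2 * (n + 1) + 1).factorial : ℝ) =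
        (2 * n + 3) * ((2 * n + 2) * ((2 * n + 1).factorial : ℝ)) := by
      rw [show 2 * (n + 1) + 1 = (2 * n + 1) + 1 + 1 by ring, Nat.factorial_succ,
        Nat.factorial_succ]
      push_cast
      ring
    rw [hf, Nat.factorial_succ]
    have hp : (0 : ℝ) < ((2 * n + 1).factorial : ℝ) := by positivity
    have h3 : (0 : ℝ) < 2 * n + 3 := by positivity
    have h2 : (0 : ℝ) < 2 * n + 2 := by positivity
    rw [eq_div_iff (by positivity)]
    have h4 := eq_neg_of_add_eq_zero_left h
    rw [show ∀ J : ℝ, J * ((2 * n + 3) * ((2 * n + 2) * ((2 * n + 1).factorial : ℝ))) =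
      ((2 * n + 3) * J) * ((2 * n + 2) * ((2 * n + 1).factorial : ℝ)) by intro J; ring, h4]
    push_cast
    field_simp
    ring

/-- After `n` integrations by parts only `(2n)! ∫ (x² - 1)^n` is left. -/
lemma integral_rodrigues_sq (n : ℕ) :
    ∫ x in (-1 : ℝ)..1, (rodrigues n * rodrigues n).eval x =
      2 ^ (2 * n + 1) * (n.factorial : ℝ) ^ 2 / (2 * n + 1) := by
  have hD : derivative^[n] (rodrigues n) = C ((2 * n).factorial : ℝ) := by
    rw [rodrigues, ← Function.iterate_add_apply, ← two_mul]
    have hdeg : (derivative^[2 * n] ((X ^ 2 - 1 : ℝ[X]) ^ n)).natDegree = 0 := by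
      have := natDegree_iterate_derivative ((X ^ 2 - 1 : ℝ[X]) ^ n) (2 * n)
      rw [natDegree_X_sq_sub_one_pow] at this
      omega
    have h1 : ((X ^ 2 - 1 : ℝ[X]) ^ n).coeff (2 * n) = 1 := by
      have := (monic_X_sq_sub_one_pow n).coeff_natDegree
      rwa [natDegree_X_sq_sub_one_pow] at this
    rw [eq_C_of_natDegree_eq_zero hdeg, coeff_iterate_derivative, zero_add, h1,
      Nat.descFactorial_self, nsmul_eq_mul, mul_one]
  conv_lhs => enter [1, x, 2, 1]; rw [rodrigues]
  rw [integral_iterate_derivative_mul_eval le_rfl, hD]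
  simp only [eval_mul, eval_C]
  rw [intervalIntegral.integral_mul_const, integral_X_sq_sub_one_pow, Nat.factorial_succ]
  push_cast
  have : ((-1 : ℝ) ^ n) * (-1) ^ n = 1 := by rw [← mul_pow]; simp
  field_simp
  linear_combination this

lemma integral_sigmaOne (g : ℝ → ℝ) :
    ∫ t, g t ∂sigmaOne = 2⁻¹ * ∫ x in (-1 : ℝ)..1, g x := by
  rw [sigmaOne, integral_smul_measure, integral_subtype_comap measurableSet_Icc,
    intervalIntegral.integral_of_le (by norm_num), integral_Icc_eq_integral_Ioc]
  simp

lemma integral_legendre_mul (m n : ℕ) :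
    ∫ t, legendre m (t : ℝ) * legendre n t ∂sigmaOne = if m = n then 1 else 0 := by
  rw [integral_sigmaOne fun x => legendre m x * legendre n x]
  have e : ∀ x, legendre m x * legendre n x =
      ((√(2 * m + 1) * (2 ^ m * (m.factorial : ℝ))⁻¹) *
        (√(2 * n + 1) * (2 ^ n * (n.factorial : ℝ))⁻¹)) * (rodrigues m * rodrigues n).eval x := by
    intro x
    rw [← eval_legendrePoly, ← eval_legendrePoly, legendrePoly, legendrePoly]
    simp only [eval_mul, eval_C]
    ring
  simp only [e]
  rw [intervalIntegral.integral_const_mul]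
  split_ifs with h
  · subst h
    rw [integral_rodrigues_sq]
    have hs : √(2 * m + 1 : ℝ) * √(2 * m + 1) = 2 * m + 1 := Real.mul_self_sqrt (by positivity)
    rw [show ∀ a b : ℝ, a * b * (a * b) = (a * a) * (b * b) by intros; ring, hs]
    field_simp
    ring
  · rcases Nat.lt_or_gt_of_ne h with h | h
    · rw [mul_comm (rodrigues m), integral_rodrigues_mul_of_lt h]; simp
    · rw [integral_rodrigues_mul_of_lt h]; simp

/-- Multiplication by the variable stays within the span of the Legendre polynomials. -/
lemma exists_mul_legendre_eq_sum (k : ℕ) :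
    ∃ c : ℕ →₀ ℝ, ∀ t : ℝ, t * legendre k t = c.sum fun j a => a * legendre j t := by
  have h : X * legendrePoly k ∈ Submodule.span ℝ (range legendrePoly) := by
    rw [span_legendrePoly]; trivial
  obtain ⟨c, hc⟩ := Finsupp.mem_span_range_iff_exists_finsupp.1 h
  refine ⟨c, fun t => ?_⟩
  have := congrArg (eval t) hc
  rw [eval_mul, eval_X, eval_legendrePoly, Finsupp.sum, eval_finsetSum] at this
  rw [← this]
  exact Finset.sum_congr rfl fun j _ => by rw [eval_smul, eval_legendrePoly, smul_eq_mul]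

end LegendreOne

/-! ### Product Legendre polynomials -/

section LegendreProduct

variable {M : Type*}

lemma legendreProd_eq_prod {ν : M →₀ ℕ} {s : Finset M} (hs : ν.support ⊆ s) (y : Y M) :
    legendreProd ν y = ∏ μ ∈ s, legendre (ν μ) (y μ) :=
  Finsupp.prod_of_support_subset _ hs _ fun _ _ => legendre_zero _

lemma integral_prod_sigma (s : Finset M) (g : M → Icc (-1 : ℝ) 1 → ℝ)
    (hg : ∀ μ, Measurable (g μ)) :
    ∫ y, ∏ μ ∈ s, g μ (y μ) ∂(sigma M) = ∏ μ ∈ s, ∫ t, g μ t ∂sigmaOne := by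
  have h := integral_restrict_infinitePi (fun _ : M => sigmaOne) (s := s)
    (f := fun z : (i : s) → Icc (-1 : ℝ) 1 => ∏ i : s, g i (z i))
    (Measurable.aestronglyMeasurable (by fun_prop))
  rw [integral_fintype_prod_eq_prod (fun (i : s) t => g i t)] at h
  rw [Finset.prod_coe_sort s fun μ => ∫ t, g μ t ∂sigmaOne] at h
  rw [← h, sigma]
  refine integral_congr_ae (ae_of_all _ fun y => ?_)
  exact (Finset.prod_coe_sort s fun μ => g μ (y μ)).symm

lemma continuous_legendreProd (ν : M →₀ ℕ) : Continuous (legendreProd ν) := by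
  refine continuous_finsetProd _ fun μ _ => (continuous_legendre _).comp ?_
  fun_prop

lemma integral_legendreProd_mul [DecidableEq (M →₀ ℕ)] (ν ν' : M →₀ ℕ) :
    ∫ y, legendreProd ν y * legendreProd ν' y ∂(sigma M) = if ν = ν' then 1 else 0 := by
  classical
  set s := ν.support ∪ ν'.support
  have h : ∀ y, legendreProd ν y * legendreProd ν' y =
      ∏ μ ∈ s, legendre (ν μ) (y μ) * legendre (ν' μ) (y μ) := fun y => by
    rw [legendreProd_eq_prod Finset.subset_union_left, legendreProd_eq_prod
      Finset.subset_union_right, Finset.prod_mul_distrib]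
  simp only [h]
  rw [integral_prod_sigma s (fun μ t => legendre (ν μ) t * legendre (ν' μ) t) fun μ =>
    (((continuous_legendre _).comp continuous_subtype_val).mul
      ((continuous_legendre _).comp continuous_subtype_val)).measurable]
  simp only [integral_legendre_mul]
  split_ifs with hν
  · simp [hν]
  · obtain ⟨μ, hμ⟩ : ∃ μ, ν μ ≠ ν' μ := by
      by_contra! hc
      exact hν (Finsupp.ext hc)
    refine Finset.prod_eq_zero (i := μ) ?_ (if_neg hμ)
    by_contra hs
    simp only [s, Finset.mem_union, Finsupp.mem_support_iff, not_or, not_not] at hs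
    exact hμ (hs.1.trans hs.2.symm)

/-- `L_ν` as a continuous function on the compact space `Y`. -/
def legendreC (ν : M →₀ ℕ) : C(Y M, ℝ) := ⟨legendreProd ν, continuous_legendreProd ν⟩

/-- The coordinate `y_μ` as a continuous function on `Y`. -/
def coordC (μ : M) : C(Y M, ℝ) := ⟨fun y => y μ, by fun_prop⟩

lemma legendreC_zero : legendreC (0 : M →₀ ℕ) = 1 := by
  ext y
  simp [legendreC, legendreProd]

lemma coordC_mul_legendreC_mem_span (μ : M) (ν : M →₀ ℕ) :
    coordC μ * legendreC ν ∈ Submodule.span ℝ (range (legendreC (M := M))) := by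
  classical
  obtain ⟨c, hc⟩ := exists_mul_legendre_eq_sum (ν μ)
  have e : coordC μ * legendreC ν = ∑ j ∈ c.support, c j • legendreC (ν.update μ j) := by
    ext y
    have hsplit : ∀ ν' : M →₀ ℕ, legendreProd ν' y = legendre (ν' μ) (y μ) *
        (ν'.erase μ).prod fun i k => legendre k (y i) := fun ν' =>
      (Finsupp.mul_prod_erase' ν' μ (fun i k => legendre k (y i : ℝ))
        fun i => legendre_zero _).symm
    simp only [legendreC, coordC, ContinuousMap.mul_apply, ContinuousMap.coe_mk,
      ContinuousMap.coe_sum, ContinuousMap.coe_smul, Finset.sum_apply, Pi.smul_apply, smul_eq_mul]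
    rw [hsplit ν, ← mul_assoc, hc, Finsupp.sum, Finset.sum_mul]
    refine Finset.sum_congr rfl fun j _ => ?_
    rw [hsplit (ν.update μ j), Finsupp.erase_update_eq_erase]
    simp [mul_assoc]
  rw [e]
  exact Submodule.sum_mem _ fun j _ =>
    Submodule.smul_mem _ _ (Submodule.subset_span (mem_range_self _))

/-- The span of the product Legendre polynomials contains all polynomials in the coordinates. -/
lemma adjoin_coordC_le_span :
    ((Algebra.adjoin ℝ (range (coordC (M := M))) : Subalgebra ℝ C(Y M, ℝ)) : Set C(Y M, ℝ)) ⊆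
      Submodule.span ℝ (range (legendreC (M := M))) := by
  have key : ∀ a ∈ Algebra.adjoin ℝ (range (coordC (M := M))),
      ∀ w ∈ Submodule.span ℝ (range (legendreC (M := M))),
        a * w ∈ Submodule.span ℝ (range (legendreC (M := M))) := by
    intro a ha
    induction ha using Algebra.adjoin_induction with
    | mem x hx =>
      obtain ⟨μ, rfl⟩ := hx
      intro w hw
      induction hw using Submodule.span_induction with
      | mem w hw =>
        obtain ⟨ν, rfl⟩ := hw
        exact coordC_mul_legendreC_mem_span μ ν
      | zero => simp
      | add v w _ _ h1 h2 => rw [mul_add]; exact Submodule.add_mem _ h1 h2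
      | smul c w _ h => rw [mul_smul_comm]; exact Submodule.smul_mem _ c h
    | algebraMap c =>
      intro w hw
      rw [← Algebra.smul_def]
      exact Submodule.smul_mem _ c hw
    | add a b _ _ h1 h2 =>
      intro w hw
      rw [add_mul]
      exact Submodule.add_mem _ (h1 w hw) (h2 w hw)
    | mul a b _ _ h1 h2 =>
      intro w hw
      rw [mul_assoc]
      exact h1 _ (h2 w hw)
  intro a ha
  have h1 : (1 : C(Y M, ℝ)) ∈ Submodule.span ℝ (range (legendreC (M := M))) :=
    Submodule.subset_span ⟨0, legendreC_zero⟩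
  simpa using key a ha 1 h1

lemma dense_span_legendreC :
    Dense (Submodule.span ℝ (range (legendreC (M := M))) : Set C(Y M, ℝ)) := by
  have hA : (Algebra.adjoin ℝ (range (coordC (M := M)))).topologicalClosure = ⊤ := by
    refine ContinuousMap.subalgebra_topologicalClosure_eq_top_of_separatesPoints _ ?_
    intro x y hxy
    obtain ⟨μ, hμ⟩ := Function.ne_iff.1 hxy
    refine ⟨coordC μ, ⟨coordC μ, Algebra.subset_adjoin (mem_range_self μ), rfl⟩, ?_⟩
    exact fun h => hμ (Subtype.ext h)
  refine Dense.mono adjoin_coordC_le_span ?_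
  rw [dense_iff_closure_eq, ← Subalgebra.topologicalClosure_coe, hA]
  rfl

variable [Countable M]

/-- `L_ν` as an element of `L₂(Y, σ)`. -/
def legendreLp (ν : M →₀ ℕ) : Lp ℝ 2 (sigma M) := ContinuousMap.toLp 2 (sigma M) ℝ (legendreC ν)

lemma coeFn_legendreLp (ν : M →₀ ℕ) : legendreLp ν =ᵐ[sigma M] legendreProd ν :=
  ContinuousMap.coeFn_toLp _ _

lemma orthonormal_legendreLp : Orthonormal ℝ (legendreLp (M := M)) := by
  classical
  rw [orthonormal_iff_ite]
  intro ν ν'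
  rw [legendreLp, legendreLp, ContinuousMap.inner_toLp]
  simp only [conj_trivial]
  exact (integral_legendreProd_mul ν' ν).trans (by simp only [eq_comm])

lemma dense_span_legendreLp :
    Dense (Submodule.span ℝ (range (legendreLp (M := M))) : Set (Lp ℝ 2 (sigma M))) := by
  have h := (ContinuousMap.toLp_denseRange ℝ (sigma M) ℝ (p := 2) (by simp)).dense_image
    (ContinuousMap.toLp 2 (sigma M) ℝ).continuous dense_span_legendreC
  refine h.mono ?_
  rintro _ ⟨g, hg, rfl⟩
  have := Submodule.mem_map_of_mem (f := (ContinuousMap.toLp 2 (sigma M) ℝ).toLinearMap) hg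
  rw [Submodule.map_span, ← range_comp] at this
  exact this

end LegendreProduct

/-! ### Expansions in `L₂(Ω; E)` along an orthonormal family of scalar functions -/

section Tensor

variable {Ω : Type*} [MeasurableSpace Ω] {μ : Measure Ω}
  {E : Type*} [NormedAddCommGroup E] [InnerProductSpace ℝ E] {N Θ : Type*}

/-- The function `x ↦ g x • v` in `L₂(Ω; E)`, for a scalar function `g` and a vector `v`. -/
def tens (g : Lp ℝ 2 μ) (v : E) : Lp E 2 μ := (ContinuousLinearMap.toSpanSingleton ℝ v).compLp g

lemma coeFn_tens (g : Lp ℝ 2 μ) (v : E) : tens g v =ᵐ[μ] fun x => g x • v := by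
  filter_upwards [(ContinuousLinearMap.toSpanSingleton ℝ v).coeFn_compLp g] with x hx
  simpa [tens] using hx

lemma inner_tens (g h : Lp ℝ 2 μ) (v w : E) :
    inner ℝ (tens g v) (tens h w) = inner ℝ g h * inner ℝ v w := by
  rw [L2.inner_def, L2.inner_def, ← integral_mul_const]
  refine integral_congr_ae ?_
  filter_upwards [coeFn_tens g v, coeFn_tens h w] with x h1 h2
  rw [h1, h2, real_inner_smul_left, real_inner_smul_right]
  simp only [RCLike.inner_apply, conj_trivial]
  ring

lemma norm_tens (g : Lp ℝ 2 μ) (v : E) : ‖tens g v‖ = ‖g‖ * ‖v‖ := by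
  have h := inner_tens g g v v
  simp only [real_inner_self_eq_norm_sq, ← mul_pow] at h
  exact (sq_eq_sq₀ (norm_nonneg _) (by positivity)).1 h

/-- `v ↦ g ⊗ v` as a continuous linear map. -/
def tensL (g : Lp ℝ 2 μ) : E →L[ℝ] Lp E 2 μ :=
  LinearMap.mkContinuous
    { toFun := tens g
      map_add' := fun v w => by
        refine Lp.ext ?_
        filter_upwards [coeFn_tens g (v + w), coeFn_tens g v, coeFn_tens g w,
          Lp.coeFn_add (tens g v) (tens g w)] with x h1 h2 h3 h4
        rw [h1, h4, Pi.add_apply, h2, h3, smul_add]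
      map_smul' := fun c v => by
        refine Lp.ext ?_
        filter_upwards [coeFn_tens g (c • v), coeFn_tens g v,
          Lp.coeFn_smul c (tens g v)] with x h1 h2 h3
        rw [h1, RingHom.id_apply, h3, Pi.smul_apply, h2, smul_comm] } ‖g‖
    fun v => (norm_tens g v).le

@[simp] lemma tensL_apply (g : Lp ℝ 2 μ) (v : E) : tensL g v = tens g v := rfl

/-- The finite sums `∑_ν ℓ_ν ⊗ v_ν`, as a linear map of the coefficients. -/
def sumTens (ℓ : N → Lp ℝ 2 μ) : (N →₀ E) →ₗ[ℝ] Lp E 2 μ :=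
  Finsupp.lsum ℝ fun ν => (tensL (ℓ ν)).toLinearMap

lemma sumTens_apply (ℓ : N → Lp ℝ 2 μ) (c : N →₀ E) :
    sumTens ℓ c = ∑ ν ∈ c.support, tens (ℓ ν) (c ν) := rfl

/-- Parseval's identity for finite expansions. -/
lemma norm_sq_sum_tens {ℓ : N → Lp ℝ 2 μ} (hℓ : Orthonormal ℝ ℓ) (s : Finset N) (v : N → E) :
    ‖∑ ν ∈ s, tens (ℓ ν) (v ν)‖ ^ 2 = ∑ ν ∈ s, ‖v ν‖ ^ 2 := by
  classical
  rw [← real_inner_self_eq_norm_sq, sum_inner]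
  refine Finset.sum_congr rfl fun ν hν => ?_
  rw [inner_sum, Finset.sum_eq_single ν]
  · rw [inner_tens, real_inner_self_eq_norm_sq, real_inner_self_eq_norm_sq, hℓ.1 ν]; ring
  · intro ν' _ hne
    rw [inner_tens, hℓ.2 hne.symm, zero_mul]
  · exact fun h => absurd hν h

/-- Completeness of the scalar family carries over to `E`-valued functions. -/
lemma denseRange_sumTens [IsFiniteMeasure μ] {ℓ : N → Lp ℝ 2 μ}
    (hd : Dense (Submodule.span ℝ (range ℓ) : Set (Lp ℝ 2 μ))) :
    DenseRange (sumTens (E := E) ℓ) := by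
  set S := (LinearMap.range (sumTens (E := E) ℓ)).topologicalClosure with hS
  have hSc : IsClosed (S : Set (Lp E 2 μ)) := Submodule.isClosed_topologicalClosure _
  have hsub : LinearMap.range (sumTens (E := E) ℓ) ≤ S := Submodule.le_topologicalClosure _
  have key : ∀ (v : E) (g : Lp ℝ 2 μ), tens g v ∈ S := by
    intro v
    let T : Lp ℝ 2 μ →L[ℝ] Lp E 2 μ := (ContinuousLinearMap.toSpanSingleton ℝ v).compLpL 2 μ
    have h1 : Submodule.span ℝ (range ℓ) ≤ S.comap T.toLinearMap := by
      rw [Submodule.span_le]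
      rintro _ ⟨ν, rfl⟩
      refine hsub ⟨Finsupp.single ν v, ?_⟩
      rw [sumTens, Finsupp.lsum_single]
      rfl
    intro g
    have h2 : IsClosed {g : Lp ℝ 2 μ | T g ∈ S} := hSc.preimage T.continuous
    exact hd.induction (P := fun g => T g ∈ S) (fun g hg => h1 hg) h2 g
  have hall : ∀ z : Lp E 2 μ, z ∈ S := by
    refine Lp.induction (by simp) _ ?_ ?_ hSc
    · intro c s hs hμs
      rw [Lp.simpleFunc.coe_indicatorConst]
      convert key c (indicatorConstLp 2 hs hμs.ne 1) using 1
      refine Lp.ext ?_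
      filter_upwards [coeFn_tens (indicatorConstLp 2 hs hμs.ne (1 : ℝ)) c,
        indicatorConstLp_coeFn (p := 2) (hs := hs) (hμs := hμs.ne) (c := c),
        indicatorConstLp_coeFn (p := 2) (hs := hs) (hμs := hμs.ne) (c := (1 : ℝ))]
        with x h1 h2 h3
      rw [h1, h2, h3]
      by_cases hx : x ∈ s <;> simp [hx]
    · intro f g hf hg _ h1 h2
      exact S.add_mem h1 h2
  intro z
  exact hall z

/-- Bessel-type duality: a functional on `L₂(Ω; E)` is bounded by the square root of the sum of the
squared norms of its components along a complete orthonormal family. -/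
lemma abs_apply_le_of_sum_norm_sq_le [IsFiniteMeasure μ] {ℓ : N → Lp ℝ 2 μ}
    (hℓ : Orthonormal ℝ ℓ) (hd : Dense (Submodule.span ℝ (range ℓ) : Set (Lp ℝ 2 μ)))
    (ξ : StrongDual ℝ (Lp E 2 μ)) {R : ℝ} (hR : 0 ≤ R)
    (h : ∀ s : Finset N, ∑ ν ∈ s, ‖ξ.comp (tensL (ℓ ν))‖ ^ 2 ≤ R ^ 2) (z : Lp E 2 μ) :
    |ξ z| ≤ R * ‖z‖ := by
  have hclosed : IsClosed {z : Lp E 2 μ | |ξ z| ≤ R * ‖z‖} :=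
    isClosed_le ξ.continuous.abs (continuous_const.mul continuous_norm)
  refine (denseRange_sumTens (E := E) hd).induction_on z hclosed fun c => ?_
  have h1 : |ξ (sumTens ℓ c)| ≤ ∑ ν ∈ c.support, ‖ξ.comp (tensL (ℓ ν))‖ * ‖c ν‖ := by
    rw [sumTens_apply, map_sum]
    refine (Finset.abs_sum_le_sum_abs _ _).trans (Finset.sum_le_sum fun ν _ => ?_)
    exact (ξ.comp (tensL (ℓ ν))).le_opNorm (c ν)
  refine h1.trans ((sq_le_sq₀ (Finset.sum_nonneg fun _ _ => by positivity) (by positivity)).1 ?_)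
  refine (Finset.sum_mul_sq_le_sq_mul_sq _ _ _).trans ?_
  rw [mul_pow, sumTens_apply, norm_sq_sum_tens hℓ]
  exact mul_le_mul_of_nonneg_right (h _) (Finset.sum_nonneg fun _ _ => by positivity)

/-- The synthesis operator of a Bessel sequence is bounded. -/
lemma norm_sq_synthesis_le {ψ : Θ → E} {C : ℝ}
    (hψ : ∀ (v : E) (t : Finset Θ), ∑ k ∈ t, (inner ℝ v (ψ k)) ^ 2 ≤ C ^ 2 * ‖v‖ ^ 2)
    (t : Finset Θ) (a : Θ → ℝ) :
    ‖∑ k ∈ t, a k • ψ k‖ ^ 2 ≤ C ^ 2 * ∑ k ∈ t, a k ^ 2 := by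
  set v := ∑ k ∈ t, a k • ψ k with hv
  have h1 : ‖v‖ ^ 2 = ∑ k ∈ t, a k * inner ℝ v (ψ k) := by
    rw [← real_inner_self_eq_norm_sq]
    nth_rewrite 2 [hv]
    rw [inner_sum]
    simp only [real_inner_smul_right]
  have h2 : (‖v‖ ^ 2) ^ 2 ≤ (∑ k ∈ t, a k ^ 2) * (C ^ 2 * ‖v‖ ^ 2) := by
    rw [h1]
    refine (Finset.sum_mul_sq_le_sq_mul_sq _ _ _).trans ?_
    rw [← h1]
    exact mul_le_mul_of_nonneg_left (hψ v t) (Finset.sum_nonneg fun _ _ => sq_nonneg _)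
  rcases (sq_nonneg ‖v‖).eq_or_lt with h0 | h0
  · rw [← h0]
    exact mul_nonneg (sq_nonneg _) (Finset.sum_nonneg fun _ _ => sq_nonneg _)
  · refine le_of_mul_le_mul_right ?_ h0
    linarith

/-- The synthesis bound for the family `ℓ_ν ⊗ ψ_k`. -/
lemma norm_sq_sum_tens_synthesis_le {ℓ : N → Lp ℝ 2 μ} (hℓ : Orthonormal ℝ ℓ) {ψ : Θ → E} {C : ℝ}
    (hψ : ∀ (v : E) (t : Finset Θ), ∑ k ∈ t, (inner ℝ v (ψ k)) ^ 2 ≤ C ^ 2 * ‖v‖ ^ 2)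
    (s : Finset (N × Θ)) (a : N × Θ → ℝ) :
    ‖∑ i ∈ s, a i • tens (ℓ i.1) (ψ i.2)‖ ^ 2 ≤ C ^ 2 * ∑ i ∈ s, a i ^ 2 := by
  classical
  -- enlarging `s` to a product set reduces the claim to one frame synthesis for each `ν`
  set A := s.image Prod.fst
  set B := s.image Prod.snd
  have hsub : s ⊆ A ×ˢ B := fun i hi =>
    Finset.mem_product.2 ⟨Finset.mem_image_of_mem _ hi, Finset.mem_image_of_mem _ hi⟩
  set b : N × Θ → ℝ := fun i => if i ∈ s then a i else 0 with hb
  have e1 : ∑ i ∈ s, a i • tens (ℓ i.1) (ψ i.2) =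
      ∑ ν ∈ A, tens (ℓ ν) (∑ k ∈ B, b (ν, k) • ψ k) := by
    calc ∑ i ∈ s, a i • tens (ℓ i.1) (ψ i.2)
        = ∑ i ∈ A ×ˢ B, b i • tens (ℓ i.1) (ψ i.2) := by
          rw [← Finset.sum_subset hsub fun i _ hi => by simp [hb, hi]]
          exact Finset.sum_congr rfl fun i hi => by simp [hb, hi]
      _ = ∑ ν ∈ A, ∑ k ∈ B, b (ν, k) • tens (ℓ ν) (ψ k) := Finset.sum_product _ _ _
      _ = _ := Finset.sum_congr rfl fun ν _ => by
          rw [← tensL_apply, map_sum]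
          simp
  have e2 : ∑ i ∈ s, a i ^ 2 = ∑ ν ∈ A, ∑ k ∈ B, b (ν, k) ^ 2 := by
    rw [← Finset.sum_product (f := fun i => b i ^ 2),
      ← Finset.sum_subset hsub fun i _ hi => by simp [hb, hi]]
    exact Finset.sum_congr rfl fun i hi => by simp [hb, hi]
  rw [e1, e2, norm_sq_sum_tens hℓ, Finset.mul_sum]
  exact Finset.sum_le_sum fun ν _ => norm_sq_synthesis_le hψ B fun k => b (ν, k)

end Tensor

/-! ### The parametric coefficient -/

section Coefficient

variable {T₀ : InitialTriangulation} {M : Type*} {θ₀ : Pt → ℝ} {θ : M → Pt → ℝ}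

/-- Bounded coefficient functions that satisfy the uniform ellipticity condition. -/
structure IsAdmissible (T₀ : InitialTriangulation) {M : Type*} (θ₀ : Pt → ℝ) (θ : M → Pt → ℝ) :
    Prop where
  memLp_zero : MemLp θ₀ ∞ (volume.restrict T₀.domain)
  memLp : ∀ μ, MemLp (θ μ) ∞ (volume.restrict T₀.domain)
  elliptic : UniformlyElliptic T₀ θ₀ θ

lemma ae_cB_le (h : UniformlyElliptic T₀ θ₀ θ) :
    ∀ᵐ x ∂(volume.restrict T₀.domain), cB T₀ θ₀ θ ≤ θ₀ x - ∑' μ, |θ μ x| := by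
  refine ae_essInf_le ?_
  -- an essential infimum over an empty set of essential lower bounds would be `0`
  have hpos := h.2
  rw [cB, essInf_eq_sSup] at hpos
  have hne : {a : ℝ | (volume.restrict T₀.domain) {x | θ₀ x - ∑' μ, |θ μ x| < a} = 0}.Nonempty := by
    by_contra hc
    rw [not_nonempty_iff_eq_empty] at hc
    rw [hc, Real.sSup_empty] at hpos
    exact lt_irrefl _ hpos
  obtain ⟨a, ha⟩ := hne
  refine ⟨a, ?_⟩
  rw [Filter.eventually_map, ae_iff]
  simpa using ha

lemma abs_coe_le_one (t : Icc (-1 : ℝ) 1) : |(t : ℝ)| ≤ 1 := abs_le.2 t.2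

lemma norm_mul_le_abs (y : Y M) (x : Pt) (μ : M) : ‖(y μ : ℝ) * θ μ x‖ ≤ |θ μ x| := by
  rw [Real.norm_eq_abs, abs_mul]
  exact mul_le_of_le_one_left (abs_nonneg _) (abs_coe_le_one _)

lemma abs_tsum_mul_le {x : Pt} (hx : Summable fun μ => |θ μ x|) (y : Y M) :
    |∑' μ, (y μ : ℝ) * θ μ x| ≤ ∑' μ, |θ μ x| :=
  tsum_of_norm_bounded hx.hasSum fun μ => norm_mul_le_abs y x μ

lemma continuous_coeff {x : Pt} (hx : Summable fun μ => |θ μ x|) :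
    Continuous fun y : Y M => coeff θ₀ θ y x := by
  refine continuous_const.add (continuous_tsum (fun μ => ?_) hx fun μ y => norm_mul_le_abs y x μ)
  fun_prop

lemma ae_cB_le_coeff (h : UniformlyElliptic T₀ θ₀ θ) :
    ∀ᵐ x ∂(volume.restrict T₀.domain), ∀ y : Y M, cB T₀ θ₀ θ ≤ coeff θ₀ θ y x := by
  filter_upwards [ae_cB_le h, h.1] with x h1 h2 y
  have := (abs_le.1 (abs_tsum_mul_le h2 y)).1
  rw [coeff]
  linarith

lemma ae_abs_le_eLpNorm_top {g : Pt → ℝ} {ν : Measure Pt} (hg : eLpNorm g ∞ ν ≠ ∞) :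
    ∀ᵐ x ∂ν, |g x| ≤ (eLpNorm g ∞ ν).toReal := by
  rw [eLpNorm_exponent_top] at hg ⊢
  filter_upwards [ae_le_eLpNormEssSup (f := g) (μ := ν)] with x hx
  have := ENNReal.toReal_mono hg hx
  simpa using this

lemma ae_abs_coeff_le (h : IsAdmissible T₀ θ₀ θ) :
    ∀ᵐ x ∂(volume.restrict T₀.domain), ∀ y : Y M,
      |coeff θ₀ θ y x| ≤ 2 * (eLpNorm θ₀ ∞ (volume.restrict T₀.domain)).toReal := by
  filter_upwards [ae_cB_le h.elliptic, h.elliptic.1,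
    ae_abs_le_eLpNorm_top h.memLp_zero.2.ne] with x h1 h2 h3 y
  have h4 := abs_tsum_mul_le h2 y
  have h5 := abs_add_le (θ₀ x) (∑' μ, (y μ : ℝ) * θ μ x)
  have h6 := h.elliptic.2
  have h7 := le_abs_self (θ₀ x)
  rw [coeff]
  linarith

lemma eLpNorm_coeff_le (h : IsAdmissible T₀ θ₀ θ) (y : Y M) :
    eLpNorm (coeff θ₀ θ y) ∞ (volume.restrict T₀.domain) ≤
      ENNReal.ofReal (2 * (eLpNorm θ₀ ∞ (volume.restrict T₀.domain)).toReal) := by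
  rw [eLpNorm_exponent_top]
  refine eLpNormEssSup_le_of_ae_bound ?_
  filter_upwards [ae_abs_coeff_le h] with x hx using hx y

lemma ae_abs_coeff_le_CB (h : IsAdmissible T₀ θ₀ θ) (y : Y M) :
    ∀ᵐ x ∂(volume.restrict T₀.domain), |coeff θ₀ θ y x| ≤ CB T₀ θ₀ θ := by
  have hbdd : BddAbove (range fun y : Y M =>
      (eLpNorm (coeff θ₀ θ y) ∞ (volume.restrict T₀.domain)).toReal) := by
    refine ⟨2 * (eLpNorm θ₀ ∞ (volume.restrict T₀.domain)).toReal, ?_⟩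
    rintro _ ⟨y, rfl⟩
    exact ENNReal.toReal_le_of_le_ofReal (by positivity) (eLpNorm_coeff_le h y)
  filter_upwards [ae_abs_le_eLpNorm_top
    ((eLpNorm_coeff_le h y).trans_lt ENNReal.ofReal_lt_top).ne] with x hx
  exact hx.trans (le_ciSup hbdd y)

lemma aestronglyMeasurable_coeff [Countable M] (h : IsAdmissible T₀ θ₀ θ) (y : Y M) :
    AEStronglyMeasurable (coeff θ₀ θ y) (volume.restrict T₀.domain) := by
  refine h.memLp_zero.1.add ?_
  refine aestronglyMeasurable_of_tendsto_ae (Filter.atTop : Filter (Finset M))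
    (f := fun s x => ∑ μ ∈ s, (y μ : ℝ) * θ μ x) (fun s => ?_) ?_
  · exact Finset.aestronglyMeasurable_fun_sum s fun μ _ => (h.memLp μ).1.const_mul _
  · filter_upwards [h.elliptic.1] with x hx
    exact (Summable.of_norm_bounded hx fun μ => norm_mul_le_abs y x μ).hasSum

/-! ### The stiffness form -/

lemma integrable_inner_grad (v w : V T₀) :
    Integrable (fun x => (inner ℝ (V.grad T₀ v x) (V.grad T₀ w x) : ℝ))
      (volume.restrict T₀.domain) :=
  L2.integrable_inner _ _

lemma V.inner_def (v w : V T₀) :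
    inner ℝ v w = ∫ x in T₀.domain, (inner ℝ (V.grad T₀ v x) (V.grad T₀ w x) : ℝ) := rfl

lemma CB_nonneg : 0 ≤ CB T₀ θ₀ θ := Real.iSup_nonneg fun _ => ENNReal.toReal_nonneg

lemma stiffness_comm (y : Y M) (v w : V T₀) :
    stiffness T₀ θ₀ θ y v w = stiffness T₀ θ₀ θ y w v := by
  simp only [stiffness, real_inner_comm]

lemma stiffness_smul_left (y : Y M) (c : ℝ) (v w : V T₀) :
    stiffness T₀ θ₀ θ y (c • v) w = c * stiffness T₀ θ₀ θ y v w := by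
  rw [stiffness, stiffness, ← integral_const_mul, map_smul]
  refine integral_congr_ae ?_
  filter_upwards [Lp.coeFn_smul c (V.grad T₀ v)] with x hx
  rw [hx, Pi.smul_apply, real_inner_smul_left]
  ring

lemma formB_comm (v w : VV T₀ M) : formB T₀ θ₀ θ v w = formB T₀ θ₀ θ w v := by
  simp only [formB, stiffness_comm _ (v _)]

lemma norm_sq_eq_integral (v : VV T₀ M) : ‖v‖ ^ 2 = ∫ y, ‖v y‖ ^ 2 ∂(sigma M) := by
  rw [← real_inner_self_eq_norm_sq, L2.inner_def]
  simp only [real_inner_self_eq_norm_sq]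

variable [Countable M]

lemma integrable_coeff_mul_inner (h : IsAdmissible T₀ θ₀ θ) (y : Y M) (v w : V T₀) :
    Integrable (fun x => coeff θ₀ θ y x * inner ℝ (V.grad T₀ v x) (V.grad T₀ w x))
      (volume.restrict T₀.domain) :=
  (integrable_inner_grad v w).bdd_mul (aestronglyMeasurable_coeff h y) (ae_abs_coeff_le_CB h y)

lemma stiffness_add_left (h : IsAdmissible T₀ θ₀ θ) (y : Y M) (v v' w : V T₀) :
    stiffness T₀ θ₀ θ y (v + v') w = stiffness T₀ θ₀ θ y v w + stiffness T₀ θ₀ θ y v' w := by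
  rw [stiffness, stiffness, stiffness, ← integral_add (integrable_coeff_mul_inner h y v w)
    (integrable_coeff_mul_inner h y v' w), map_add]
  refine integral_congr_ae ?_
  filter_upwards [Lp.coeFn_add (V.grad T₀ v) (V.grad T₀ v')] with x hx
  rw [hx, Pi.add_apply, inner_add_left, mul_add]

/-- `(v, w) ↦ ∫_D a(y) ∇v · ∇w dx` as a bilinear form on `V`. -/
def stiffnessBilin (h : IsAdmissible T₀ θ₀ θ) (y : Y M) : LinearMap.BilinForm ℝ (V T₀) :=
  LinearMap.mk₂ ℝ (stiffness T₀ θ₀ θ y) (stiffness_add_left h y) (stiffness_smul_left y)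
    (fun v w w' => by
      rw [stiffness_comm, stiffness_add_left h, stiffness_comm y w, stiffness_comm y w'])
    (fun c v w => by rw [stiffness_comm, stiffness_smul_left, stiffness_comm]; rfl)

lemma stiffnessBilin_apply (h : IsAdmissible T₀ θ₀ θ) (y : Y M) (v w : V T₀) :
    stiffnessBilin h y v w = stiffness T₀ θ₀ θ y v w := rfl

lemma cB_mul_norm_sq_le_stiffness (h : IsAdmissible T₀ θ₀ θ) (y : Y M) (v : V T₀) :
    cB T₀ θ₀ θ * ‖v‖ ^ 2 ≤ stiffness T₀ θ₀ θ y v v := by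
  rw [← real_inner_self_eq_norm_sq, V.inner_def, ← integral_const_mul]
  refine integral_mono_ae ((integrable_inner_grad v v).const_mul _)
    (integrable_coeff_mul_inner h y v v) ?_
  filter_upwards [ae_cB_le_coeff h.elliptic] with x hx
  exact mul_le_mul_of_nonneg_right (hx y) real_inner_self_nonneg

lemma stiffness_le_CB_mul_norm_sq (h : IsAdmissible T₀ θ₀ θ) (y : Y M) (v : V T₀) :
    stiffness T₀ θ₀ θ y v v ≤ CB T₀ θ₀ θ * ‖v‖ ^ 2 := by
  rw [← real_inner_self_eq_norm_sq, V.inner_def, ← integral_const_mul]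
  refine integral_mono_ae (integrable_coeff_mul_inner h y v v)
    ((integrable_inner_grad v v).const_mul _) ?_
  filter_upwards [ae_abs_coeff_le_CB h y] with x hx
  exact mul_le_mul_of_nonneg_right ((le_abs_self _).trans hx) real_inner_self_nonneg

lemma stiffness_self_nonneg (h : IsAdmissible T₀ θ₀ θ) (y : Y M) (v : V T₀) :
    0 ≤ stiffness T₀ θ₀ θ y v v :=
  (mul_nonneg h.elliptic.2.le (sq_nonneg _)).trans (cB_mul_norm_sq_le_stiffness h y v)

lemma abs_stiffness_le (h : IsAdmissible T₀ θ₀ θ) (y : Y M) (v w : V T₀) :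
    |stiffness T₀ θ₀ θ y v w| ≤ CB T₀ θ₀ θ * (‖v‖ * ‖w‖) := by
  have h1 := (stiffnessBilin h y).apply_sq_le_of_symm (stiffness_self_nonneg h y)
    ⟨fun v w => stiffness_comm y v w⟩ v w
  simp only [stiffnessBilin_apply] at h1
  refine abs_le_of_sq_le_sq (h1.trans ?_) (mul_nonneg CB_nonneg (by positivity))
  calc _ ≤ (CB T₀ θ₀ θ * ‖v‖ ^ 2) * (CB T₀ θ₀ θ * ‖w‖ ^ 2) :=
        mul_le_mul (stiffness_le_CB_mul_norm_sq h y v) (stiffness_le_CB_mul_norm_sq h y w)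
          (stiffness_self_nonneg h y w) (mul_nonneg CB_nonneg (sq_nonneg _))
    _ = _ := by ring

lemma continuous_stiffness_param (h : IsAdmissible T₀ θ₀ θ) (v w : V T₀) :
    Continuous fun y : Y M => stiffness T₀ θ₀ θ y v w := by
  refine continuous_of_dominated
    (bound := fun x => 2 * (eLpNorm θ₀ ∞ (volume.restrict T₀.domain)).toReal *
      ‖(inner ℝ (V.grad T₀ v x) (V.grad T₀ w x) : ℝ)‖)
    (fun y => (integrable_coeff_mul_inner h y v w).1) (fun y => ?_)
    ((integrable_inner_grad v w).norm.const_mul _) ?_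
  · filter_upwards [ae_abs_coeff_le h] with x hx
    rw [norm_mul]
    exact mul_le_mul_of_nonneg_right (hx y) (norm_nonneg _)
  · filter_upwards [h.elliptic.1] with x hx
    exact (continuous_coeff hx).mul continuous_const

/-- Although `y ↦ a(y)` need not be continuous into `L_∞(D)`, the stiffness form is jointly
continuous. -/
lemma continuous_stiffness (h : IsAdmissible T₀ θ₀ θ) :
    Continuous fun p : Y M × V T₀ × V T₀ => stiffness T₀ θ₀ θ p.1 p.2.1 p.2.2 := by
  rw [continuous_iff_continuousAt]
  rintro ⟨y₀, v₀, w₀⟩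
  rw [ContinuousAt, tendsto_iff_dist_tendsto_zero]
  have hcont : Continuous fun p : Y M × V T₀ × V T₀ =>
      CB T₀ θ₀ θ * (‖p.2.1 - v₀‖ * ‖p.2.2‖) + CB T₀ θ₀ θ * (‖v₀‖ * ‖p.2.2 - w₀‖) +
        |stiffness T₀ θ₀ θ p.1 v₀ w₀ - stiffness T₀ θ₀ θ y₀ v₀ w₀| := by
    have := (continuous_stiffness_param h v₀ w₀).comp
      (continuous_fst (X := Y M) (Y := V T₀ × V T₀))
    simp only [Function.comp_def] at this
    fun_prop
  have hlim := hcont.tendsto (y₀, v₀, w₀)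
  simp only [sub_self, norm_zero, zero_mul, mul_zero, add_zero, abs_zero] at hlim
  refine squeeze_zero (fun _ => dist_nonneg) (fun p => ?_) hlim
  have e : stiffness T₀ θ₀ θ p.1 p.2.1 p.2.2 - stiffness T₀ θ₀ θ y₀ v₀ w₀ =
      stiffness T₀ θ₀ θ p.1 (p.2.1 - v₀) p.2.2 + stiffness T₀ θ₀ θ p.1 v₀ (p.2.2 - w₀) +
        (stiffness T₀ θ₀ θ p.1 v₀ w₀ - stiffness T₀ θ₀ θ y₀ v₀ w₀) := by
    simp only [← stiffnessBilin_apply h, map_sub, LinearMap.sub_apply]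
    ring
  rw [Real.dist_eq, e]
  refine (abs_add_three _ _ _).trans ?_
  gcongr
  · exact abs_stiffness_le h _ _ _
  · exact abs_stiffness_le h _ _ _

/-! ### The energy form on `𝒱` -/

lemma integrable_stiffness (h : IsAdmissible T₀ θ₀ θ) (v w : VV T₀ M) :
    Integrable (fun y => stiffness T₀ θ₀ θ y (v y) (w y)) (sigma M) := by
  have hm : AEStronglyMeasurable (fun y => stiffness T₀ θ₀ θ y (v y) (w y)) (sigma M) :=
    (continuous_stiffness h).comp_aestronglyMeasurable
      (continuous_id.aestronglyMeasurable.prodMk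
        ((Lp.aestronglyMeasurable v).prodMk (Lp.aestronglyMeasurable w)))
  have hi : Integrable (fun y => ‖v y‖ * ‖w y‖) (sigma M) :=
    (Lp.memLp v).norm.integrable_mul (Lp.memLp w).norm
  exact (hi.const_mul (CB T₀ θ₀ θ)).mono' hm (ae_of_all _ fun y => abs_stiffness_le h y _ _)

/-- The operator `B` as a bilinear form on `𝒱`. -/
def bilinB (h : IsAdmissible T₀ θ₀ θ) : LinearMap.BilinForm ℝ (VV T₀ M) :=
  have hadd : ∀ v v' w : VV T₀ M,
      formB T₀ θ₀ θ (v + v') w = formB T₀ θ₀ θ v w + formB T₀ θ₀ θ v' w := fun v v' w => by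
    rw [formB, formB, formB,
      ← integral_add (integrable_stiffness h v w) (integrable_stiffness h v' w)]
    refine integral_congr_ae ?_
    filter_upwards [Lp.coeFn_add v v'] with y hy
    rw [hy, Pi.add_apply, stiffness_add_left h]
  have hsmul : ∀ (c : ℝ) (v w : VV T₀ M),
      formB T₀ θ₀ θ (c • v) w = c * formB T₀ θ₀ θ v w := fun c v w => by
    rw [formB, formB, ← integral_const_mul]
    refine integral_congr_ae ?_
    filter_upwards [Lp.coeFn_smul c v] with y hy
    rw [hy, Pi.smul_apply, stiffness_smul_left]
  LinearMap.mk₂ ℝ (formB T₀ θ₀ θ) hadd hsmul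
    (fun v w w' => by rw [formB_comm, hadd, formB_comm w, formB_comm w'])
    (fun c v w => by rw [formB_comm, hsmul, formB_comm]; rfl)

@[simp] lemma bilinB_apply (h : IsAdmissible T₀ θ₀ θ) (v w : VV T₀ M) :
    bilinB h v w = formB T₀ θ₀ θ v w := rfl

lemma cB_mul_norm_sq_le_formB (h : IsAdmissible T₀ θ₀ θ) (v : VV T₀ M) :
    cB T₀ θ₀ θ * ‖v‖ ^ 2 ≤ formB T₀ θ₀ θ v v := by
  rw [norm_sq_eq_integral, ← integral_const_mul]
  exact integral_mono (((Lp.memLp v).integrable_norm_pow two_ne_zero).const_mul _)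
    (integrable_stiffness h v v) fun y => cB_mul_norm_sq_le_stiffness h y _

lemma formB_le_CB_mul_norm_sq (h : IsAdmissible T₀ θ₀ θ) (v : VV T₀ M) :
    formB T₀ θ₀ θ v v ≤ CB T₀ θ₀ θ * ‖v‖ ^ 2 := by
  rw [norm_sq_eq_integral, ← integral_const_mul]
  exact integral_mono (integrable_stiffness h v v)
    (((Lp.memLp v).integrable_norm_pow two_ne_zero).const_mul _)
    fun y => stiffness_le_CB_mul_norm_sq h y _

lemma formB_self_nonneg (h : IsAdmissible T₀ θ₀ θ) (v : VV T₀ M) : 0 ≤ formB T₀ θ₀ θ v v :=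
  (mul_nonneg h.elliptic.2.le (sq_nonneg _)).trans (cB_mul_norm_sq_le_formB h v)

/-- The Cauchy-Schwarz inequality for the energy form. -/
lemma formB_sq_le (h : IsAdmissible T₀ θ₀ θ) (v w : VV T₀ M) :
    formB T₀ θ₀ θ v w ^ 2 ≤ formB T₀ θ₀ θ v v * formB T₀ θ₀ θ w w :=
  (bilinB h).apply_sq_le_of_symm (formB_self_nonneg h) ⟨fun v w => formB_comm v w⟩ v w

/-- The functional `B v ∈ 𝒱'`. -/
def functionalB (h : IsAdmissible T₀ θ₀ θ) (v : VV T₀ M) : StrongDual ℝ (VV T₀ M) :=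
  LinearMap.mkContinuous (bilinB h v) (CB T₀ θ₀ θ * ‖v‖) fun w => by
    refine abs_le_of_sq_le_sq ((formB_sq_le h v w).trans ?_)
      (mul_nonneg (mul_nonneg CB_nonneg (norm_nonneg _)) (norm_nonneg _))
    calc _ ≤ (CB T₀ θ₀ θ * ‖v‖ ^ 2) * (CB T₀ θ₀ θ * ‖w‖ ^ 2) :=
          mul_le_mul (formB_le_CB_mul_norm_sq h v) (formB_le_CB_mul_norm_sq h w)
            (formB_self_nonneg h w) (mul_nonneg CB_nonneg (sq_nonneg _))
      _ = _ := by ring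

@[simp] lemma functionalB_apply (h : IsAdmissible T₀ θ₀ θ) (v w : VV T₀ M) :
    functionalB h v w = formB T₀ θ₀ θ v w := rfl

end Coefficient

/-! ### The `ℓ₂` norm -/

section EllTwo

variable {ι : Type*}

lemma ellTwo_sq (r : ι → ℝ) : ellTwo r ^ 2 = ∑' i, ‖r i‖ₑ ^ 2 := by
  rw [ellTwo, ← ENNReal.rpow_natCast, ← ENNReal.rpow_mul]
  norm_num

lemma ellTwo_le_iff {r : ι → ℝ} {K : ℝ≥0∞} :
    ellTwo r ≤ K ↔ ∀ s : Finset ι, ∑ i ∈ s, ‖r i‖ₑ ^ 2 ≤ K ^ 2 := by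
  rw [← ENNReal.pow_le_pow_left_iff two_ne_zero, ellTwo_sq, ENNReal.tsum_eq_iSup_sum, iSup_le_iff]

lemma sum_enorm_sq (r : ι → ℝ) (s : Finset ι) :
    ∑ i ∈ s, ‖r i‖ₑ ^ 2 = ENNReal.ofReal (∑ i ∈ s, r i ^ 2) := by
  rw [ENNReal.ofReal_sum_of_nonneg fun _ _ => sq_nonneg _]
  refine Finset.sum_congr rfl fun i _ => ?_
  rw [Real.enorm_eq_ofReal_abs, ← ENNReal.ofReal_pow (abs_nonneg _), sq_abs]

lemma ellTwo_le_ofReal {r : ι → ℝ} {K : ℝ} (hK : 0 ≤ K)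
    (h : ∀ s : Finset ι, ∑ i ∈ s, r i ^ 2 ≤ K ^ 2) : ellTwo r ≤ ENNReal.ofReal K :=
  ellTwo_le_iff.2 fun s => by
    rw [sum_enorm_sq, ← ENNReal.ofReal_pow hK]
    exact ENNReal.ofReal_le_ofReal (h s)

lemma ellTwo_add_le (r q : ι → ℝ) : ellTwo (r + q) ≤ ellTwo r + ellTwo q := by
  refine ellTwo_le_iff.2 fun s => ?_
  have e : ∀ x : ℝ≥0∞, x ^ (2 : ℝ) = x ^ 2 := fun x => ENNReal.rpow_two x
  have hle : ∀ p : ι → ℝ, (∑ i ∈ s, ‖p i‖ₑ ^ 2) ^ ((1 : ℝ) / 2) ≤ ellTwo p := fun p =>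
    ENNReal.rpow_le_rpow (ENNReal.sum_le_tsum s) (by norm_num)
  have h := ENNReal.Lp_add_le s (fun i => ‖r i‖ₑ) (fun i => ‖q i‖ₑ) (p := 2) (by norm_num)
  simp only [e] at h
  have h1 : (∑ i ∈ s, ‖(r + q) i‖ₑ ^ 2) ^ ((1 : ℝ) / 2) ≤ ellTwo r + ellTwo q := by
    refine le_trans (ENNReal.rpow_le_rpow ?_ (by norm_num)) (h.trans (add_le_add (hle r) (hle q)))
    refine Finset.sum_le_sum fun i _ => ?_
    gcongr
    exact enorm_add_le _ _
  calc _ = ((∑ i ∈ s, ‖(r + q) i‖ₑ ^ 2) ^ ((1 : ℝ) / 2)) ^ 2 := by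
        rw [← ENNReal.rpow_natCast, ← ENNReal.rpow_mul]
        norm_num
    _ ≤ _ := by gcongr

lemma ellTwo_neg (r : ι → ℝ) : ellTwo (-r) = ellTwo r := by
  simp [ellTwo]

lemma ellTwo_mono {r q : ι → ℝ} (h : ∀ i, |r i| ≤ |q i|) : ellTwo r ≤ ellTwo q := by
  refine ENNReal.rpow_le_rpow (ENNReal.tsum_le_tsum fun i => ?_) (by norm_num)
  gcongr
  rw [Real.enorm_eq_ofReal_abs, Real.enorm_eq_ofReal_abs]
  exact ENNReal.ofReal_le_ofReal (h i)

lemma ellTwo_indicator_le (Λ : Set ι) (r : ι → ℝ) : ellTwo (Λ.indicator r) ≤ ellTwo r :=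
  ellTwo_mono fun i => by by_cases hi : i ∈ Λ <;> simp [hi]

/-- Bulk chasing with an approximate residual implies bulk chasing for the exact residual. -/
lemma bulk_of_approx_bulk {ρ r : ι → ℝ} {Λ : Set ι} {ζ ω₀ : ℝ} (hζ : 0 ≤ ζ) (hω₀ : 0 < ω₀)
    (hρ : ellTwo ρ ≠ ∞) (hres : ellTwo (ρ - r) ≤ ENNReal.ofReal ζ * ellTwo ρ)
    (hbulk : ENNReal.ofReal ω₀ * ellTwo r ≤ ellTwo (Λ.indicator r)) :
    (ω₀ - (1 + ω₀) * ζ) * (ellTwo ρ).toReal ≤ (ellTwo (Λ.indicator ρ)).toReal := by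
  have hx : ellTwo (Λ.indicator ρ) ≠ ∞ := ((ellTwo_indicator_le Λ ρ).trans_lt hρ.lt_top).ne
  have hd : ENNReal.ofReal ζ * ellTwo ρ ≠ ∞ := ENNReal.mul_ne_top ENNReal.ofReal_ne_top hρ
  have h1 : ENNReal.ofReal ω₀ * ellTwo r ≤
      ellTwo (Λ.indicator ρ) + ENNReal.ofReal ζ * ellTwo ρ := by
    refine hbulk.trans ?_
    have e : Λ.indicator r = Λ.indicator ρ + -Λ.indicator (ρ - r) := by
      ext i
      by_cases hi : i ∈ Λ <;> simp [hi]
    rw [e]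
    refine (ellTwo_add_le _ _).trans (add_le_add le_rfl ?_)
    rw [ellTwo_neg]
    exact (ellTwo_indicator_le _ _).trans hres
  have hr : ellTwo r ≠ ∞ := by
    intro htop
    rw [htop, ENNReal.mul_top (ENNReal.ofReal_pos.2 hω₀).ne', top_le_iff] at h1
    exact ENNReal.add_ne_top.2 ⟨hx, hd⟩ h1
  have h2 : ellTwo ρ ≤ ellTwo r + ENNReal.ofReal ζ * ellTwo ρ := by
    calc ellTwo ρ = ellTwo (r + (ρ - r)) := by rw [add_sub_cancel]
      _ ≤ _ := (ellTwo_add_le _ _).trans (add_le_add le_rfl hres)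
  have h1' := ENNReal.toReal_mono (ENNReal.add_ne_top.2 ⟨hx, hd⟩) h1
  have h2' := ENNReal.toReal_mono (ENNReal.add_ne_top.2 ⟨hr, hd⟩) h2
  rw [ENNReal.toReal_add hx hd, ENNReal.toReal_mul, ENNReal.toReal_mul,
    ENNReal.toReal_ofReal hω₀.le, ENNReal.toReal_ofReal hζ] at h1'
  rw [ENNReal.toReal_add hr hd, ENNReal.toReal_mul, ENNReal.toReal_ofReal hζ] at h2'
  have := mul_le_mul_of_nonneg_left h2' hω₀.le
  linarith

end EllTwo

/-! ### Finite element spaces under refinement -/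

section FiniteElements

variable {T₀ : InitialTriangulation} {M : Type*}

lemma Tri.hull_subset_of_mem_children {K K' : Tri} (h : K' ∈ K.children) : K'.hull ⊆ K.hull := by
  have hv : K.verts ⊆ K.hull := subset_convexHull ℝ _
  have hm : midpoint ℝ K.b₁ K.b₂ ∈ K.hull :=
    (convex_convexHull ℝ K.verts).midpoint_mem (hv (by simp [Tri.verts])) (hv (by simp [Tri.verts]))
  refine convexHull_min ?_ (convex_convexHull ℝ _)
  rcases h with rfl | rfl
  · rintro p (rfl | rfl | rfl)
    exacts [hm, hv (by simp [Tri.verts]), hv (by simp [Tri.verts])]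
  · rintro p (rfl | rfl | rfl)
    exacts [hm, hv (by simp [Tri.verts]), hv (by simp [Tri.verts])]

lemma feSpace_mono {𝒯 𝒯' : Set Tri} (h : MeshLE 𝒯 𝒯') : feSpace T₀ 𝒯 ≤ feSpace T₀ 𝒯' := by
  induction h with
  | refl => exact le_rfl
  | tail _ hstep ih =>
    refine ih.trans ?_
    obtain ⟨K, hK, rfl⟩ := hstep
    rintro v hv K' (hK' | hK')
    · exact hv K' hK'.1
    · obtain ⟨l, hl⟩ := hv K hK
      refine ⟨l, ?_⟩
      filter_upwards [hl] with x hx hxK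
      exact hx (Tri.hull_subset_of_mem_children hK' hxK)

lemma MeshFamily.space_mono {𝕋 𝕋' : MeshFamily T₀ M} (h : 𝕋.RefinedBy 𝕋') :
    𝕋.space ⊆ 𝕋'.space := by
  classical
  rintro w ⟨c, hc, hw⟩
  refine ⟨fun ν => if ν ∈ 𝕋.F then c ν else 0, fun ν _ => ?_, ?_⟩
  · dsimp only
    split_ifs with hν
    · exact feSpace_mono (h.2 ν hν) (hc ν hν)
    · exact Submodule.zero_mem _
  · filter_upwards [hw] with y hy
    rw [hy, ← Finset.sum_subset h.1 fun ν _ hν => by simp [hν]]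
    exact Finset.sum_congr rfl fun ν hν => by simp [hν]

lemma MeshFamily.sub_mem_space {𝕋 : MeshFamily T₀ M} {v w : VV T₀ M} (hv : v ∈ 𝕋.space)
    (hw : w ∈ 𝕋.space) : v - w ∈ 𝕋.space := by
  obtain ⟨c, hc, hcv⟩ := hv
  obtain ⟨d, hd, hdw⟩ := hw
  refine ⟨fun ν => c ν - d ν, fun ν hν => Submodule.sub_mem _ (hc ν hν) (hd ν hν), ?_⟩
  filter_upwards [Lp.coeFn_sub v w, hcv, hdw] with y h1 h2 h3
  rw [h1, Pi.sub_apply, h2, h3, ← Finset.sum_sub_distrib]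
  simp only [smul_sub]

variable [Countable M]

lemma MeshFamily.tens_mem_space {𝕋 : MeshFamily T₀ M} {Λ : Set ((M →₀ ℕ) × Theta T₀)}
    (h : 𝕋.IsRefine Λ) {i : (M →₀ ℕ) × Theta T₀} (hi : i ∈ Λ) :
    tens (legendreLp i.1) (frame T₀ i.2) ∈ 𝕋.space := by
  classical
  have hF : i.1 ∈ 𝕋.F := by
    have : i.1 ∈ (𝕋.F : Set (M →₀ ℕ)) := by
      rw [h.1]
      exact mem_image_of_mem _ hi
    exact this
  refine ⟨fun ν => if ν = i.1 then frame T₀ i.2 else 0, fun ν hν => ?_, ?_⟩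
  · dsimp only
    split_ifs with hi'
    · subst hi'
      exact (h.2 _ hν).1 (Submodule.subset_span (mem_image_of_mem _ hi))
    · exact Submodule.zero_mem _
  · filter_upwards [coeFn_tens (legendreLp i.1) (frame T₀ i.2), coeFn_legendreLp i.1] with y h1 h2
    rw [h1, h2, Finset.sum_eq_single i.1 (fun ν _ hν => by simp [hν]) fun h => absurd hF h]
    simp

end FiniteElements

/-! ### Frame bounds -/

section FrameBounds

variable {T₀ : InitialTriangulation}

lemma exists_ne_zero (hV : feSpace T₀ T₀.cells ≠ ⊥) : ∃ v : V T₀, v ≠ 0 :=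
  let ⟨v, _, hv⟩ := Submodule.exists_mem_ne_zero_of_ne_bot hV
  ⟨v, hv⟩

lemma IsFrameBounds.sum_inner_sq_le {c C : ℝ} (h : IsFrameBounds T₀ c C) (v : V T₀)
    (t : Finset (Theta T₀)) :
    ∑ k ∈ t, (inner ℝ v (frame T₀ k)) ^ 2 ≤ C ^ 2 * ‖v‖ ^ 2 := by
  have h1 := (ENNReal.sum_le_tsum t).trans (h (innerSL ℝ v)).2
  rw [sum_enorm_sq (fun k => innerSL ℝ v (frame T₀ k)), innerSL_apply_norm,
    ENNReal.ofReal_le_ofReal_iff (by positivity)] at h1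
  exact h1

lemma IsFrameBounds.le {c C : ℝ} (hV : feSpace T₀ T₀.cells ≠ ⊥) (h : IsFrameBounds T₀ c C) :
    c ^ 2 ≤ C ^ 2 := by
  obtain ⟨v, hv⟩ := exists_ne_zero hV
  have hv' : 0 < ‖v‖ := norm_pos_iff.2 hv
  have h1 := (h (innerSL ℝ v)).1.trans (h (innerSL ℝ v)).2
  rw [innerSL_apply_norm, ENNReal.ofReal_le_ofReal_iff (by positivity)] at h1
  exact le_of_mul_le_mul_right h1 (by positivity)

lemma enorm_dual (ξ : StrongDual ℝ (V T₀)) : ‖ξ‖ₑ = ENNReal.ofReal ‖ξ‖ := (ofReal_norm ξ).symm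

lemma enorm_dual_sq_ne_top (ξ : StrongDual ℝ (V T₀)) : ‖ξ‖ₑ ^ 2 ≠ ∞ := by
  rw [enorm_dual]
  exact ENNReal.pow_ne_top ENNReal.ofReal_ne_top

/-- Stated separately because instance search does not find a `NormedAddGroup` structure on the dual of
`V`, whose vector space structure is declared apart from its norm. -/
lemma enorm_dual_sq_ne_zero {ξ : StrongDual ℝ (V T₀)} (h : ξ ≠ 0) : ‖ξ‖ₑ ^ 2 ≠ 0 := by
  rw [enorm_dual]
  refine pow_ne_zero _ (ENNReal.ofReal_pos.2 ((norm_nonneg ξ).lt_of_ne fun h0 => h ?_)).ne'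
  ext v
  have := ξ.le_opNorm v
  rw [← h0, zero_mul] at this
  exact norm_le_zero_iff.1 this

lemma enorm_dual_zero : ‖(0 : StrongDual ℝ (V T₀))‖ₑ = 0 := by
  rw [enorm_dual]
  exact ENNReal.ofReal_eq_zero.2 (ContinuousLinearMap.opNorm_zero (E := V T₀)).le

lemma frameSum_zero : frameSum T₀ 0 = 0 := by simp [frameSum]

lemma lowerFrameBoundSq_mul_le (ξ : StrongDual ℝ (V T₀)) :
    lowerFrameBoundSq T₀ * ‖ξ‖ₑ ^ 2 ≤ frameSum T₀ ξ := by
  rcases eq_or_ne ξ 0 with rfl | hξ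
  · simp [enorm_dual_zero]
  · have h0 : ‖ξ‖ₑ ^ 2 ≠ 0 := enorm_dual_sq_ne_zero hξ
    have ht : ‖ξ‖ₑ ^ 2 ≠ ∞ := enorm_dual_sq_ne_top ξ
    rw [← ENNReal.le_div_iff_mul_le (Or.inl h0) (Or.inl ht)]
    refine sSup_le fun k hk => ?_
    rw [ENNReal.le_div_iff_mul_le (Or.inl h0) (Or.inl ht)]
    exact hk ξ

lemma frameSum_le_upperFrameBoundSq_mul (ξ : StrongDual ℝ (V T₀)) :
    frameSum T₀ ξ ≤ upperFrameBoundSq T₀ * ‖ξ‖ₑ ^ 2 := by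
  rcases eq_or_ne ξ 0 with rfl | hξ
  · simp [frameSum_zero]
  · have h0 : ‖ξ‖ₑ ^ 2 ≠ 0 := enorm_dual_sq_ne_zero hξ
    have ht : ‖ξ‖ₑ ^ 2 ≠ ∞ := enorm_dual_sq_ne_top ξ
    rw [← ENNReal.div_le_iff h0 ht]
    refine le_sInf fun k hk => ?_
    rw [ENNReal.div_le_iff h0 ht]
    exact hk ξ

lemma lowerFrameBoundSq_le_upperFrameBoundSq (hV : feSpace T₀ T₀.cells ≠ ⊥) :
    lowerFrameBoundSq T₀ ≤ upperFrameBoundSq T₀ := by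
  obtain ⟨v, hv⟩ := exists_ne_zero hV
  have hξ : innerSL ℝ v ≠ 0 := by
    intro h0
    refine hv (inner_self_eq_zero (𝕜 := ℝ).1 ?_)
    rw [← innerSL_apply_apply, h0]
    rfl
  refine (ENNReal.mul_le_mul_iff_left (enorm_dual_sq_ne_zero hξ)
    (enorm_dual_sq_ne_top _)).1 ?_
  exact (lowerFrameBoundSq_mul_le _).trans (frameSum_le_upperFrameBoundSq_mul _)

/-- If they are finite, the best constants are frame bounds themselves. -/
lemma isFrameBounds_best (hL : lowerFrameBoundSq T₀ ≠ ∞) (hU : upperFrameBoundSq T₀ ≠ ∞) :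
    IsFrameBounds T₀ √(lowerFrameBoundSq T₀).toReal √(upperFrameBoundSq T₀).toReal := by
  have e : ∀ (k : ℝ≥0∞) (ξ : StrongDual ℝ (V T₀)), k ≠ ∞ →
      ENNReal.ofReal (√k.toReal ^ 2 * ‖ξ‖ ^ 2) = k * ‖ξ‖ₑ ^ 2 := fun k ξ hk => by
    rw [Real.sq_sqrt ENNReal.toReal_nonneg, ENNReal.ofReal_mul ENNReal.toReal_nonneg,
      ENNReal.ofReal_toReal hk, ENNReal.ofReal_pow (norm_nonneg ξ), enorm_dual]
  intro ξ
  rw [e _ _ hL, e _ _ hU]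
  exact ⟨lowerFrameBoundSq_mul_le ξ, frameSum_le_upperFrameBoundSq_mul ξ⟩

end FrameBounds

/-! ### The frame residual and error reduction -/

section Saturation

variable {T₀ : InitialTriangulation} {M : Type*} {θ₀ : Pt → ℝ} {θ : M → Pt → ℝ}

lemma load_smul (f : Pt → ℝ) (c : ℝ) (v : V T₀) : load T₀ f (c • v) = c * load T₀ f v := by
  rw [load, load, ← integral_const_mul, map_smul]
  refine integral_congr_ae ?_
  filter_upwards [Lp.coeFn_smul c (V.fn T₀ v)] with x hx
  rw [hx, Pi.smul_apply, smul_eq_mul]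
  ring

/-- If `Ψ` is not a frame, the `ℝ≥0∞` arithmetic evaluates `1 / C_{B,Ψ}` to `0` or `∞`, and
`toReal` sends both to `0`. -/
lemma toReal_inv_saturationConst_eq_zero (hCB : 0 < CB T₀ θ₀ θ)
    (hdeg : lowerFrameBoundSq T₀ = 0 ∨ upperFrameBoundSq T₀ = ∞) :
    ((saturationConst T₀ θ₀ θ)⁻¹).toReal = 0 := by
  have hCB' : ENNReal.ofReal (CB T₀ θ₀ θ) ≠ 0 := (ENNReal.ofReal_pos.2 hCB).ne'
  rw [saturationConst]
  rcases hdeg with h0 | h0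
  · rw [h0, zero_mul]
    rcases eq_or_ne (upperFrameBoundSq T₀ * ENNReal.ofReal (CB T₀ θ₀ θ)) 0 with h1 | h1
    · simp [h1]
    · simp [ENNReal.div_zero h1]
  · rw [h0, ENNReal.top_mul hCB']
    rcases eq_or_ne (lowerFrameBoundSq T₀ * ENNReal.ofReal (cB T₀ θ₀ θ)) ∞ with h1 | h1
    · simp [h1]
    · simp [ENNReal.top_div_of_ne_top h1]

lemma toReal_inv_saturationConst (hcB : 0 < cB T₀ θ₀ θ) :
    ((saturationConst T₀ θ₀ θ)⁻¹).toReal =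
      (√(upperFrameBoundSq T₀).toReal ^ 2 * CB T₀ θ₀ θ /
        (√(lowerFrameBoundSq T₀).toReal ^ 2 * cB T₀ θ₀ θ))⁻¹ := by
  rw [saturationConst, ENNReal.toReal_inv, ENNReal.toReal_div, ENNReal.toReal_mul,
    ENNReal.toReal_mul, ENNReal.toReal_ofReal CB_nonneg, ENNReal.toReal_ofReal hcB.le,
    Real.sq_sqrt ENNReal.toReal_nonneg, Real.sq_sqrt ENNReal.toReal_nonneg]

variable [Countable M]

/-- The frame coefficients of the residual test the error against the functions `L_ν ψ_lam`. -/
lemma residual_eq (h : IsAdmissible T₀ θ₀ θ) {f : Pt → ℝ} {u : VV T₀ M}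
    (hu : ∀ v : VV T₀ M, formB T₀ θ₀ θ u v = loadPhi T₀ f v) (w : VV T₀ M)
    (i : (M →₀ ℕ) × Theta T₀) :
    residual T₀ θ₀ θ f w i =
      formB T₀ θ₀ θ (w - u) (tens (legendreLp i.1) (frame T₀ i.2)) := by
  have hL : Integrable (legendreProd i.1) (sigma M) :=
    ((Lp.memLp (legendreLp i.1)).integrable (by norm_num)).congr (coeFn_legendreLp i.1)
  have ht : tens (legendreLp i.1) (frame T₀ i.2) =ᵐ[sigma M]
      fun y => legendreProd i.1 y • frame T₀ i.2 := by
    filter_upwards [coeFn_tens (legendreLp i.1) (frame T₀ i.2), coeFn_legendreLp i.1] with y h1 h2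
    rw [h1, h2]
  have h1 : (fun y => stiffness T₀ θ₀ θ y (w y) (tens (legendreLp i.1) (frame T₀ i.2) y))
      =ᵐ[sigma M] fun y => stiffness T₀ θ₀ θ y (w y) (frame T₀ i.2) * legendreProd i.1 y := by
    filter_upwards [ht] with y hy
    rw [hy, stiffness_comm, stiffness_smul_left, stiffness_comm, mul_comm]
  have h2 : loadPhi T₀ f (tens (legendreLp i.1) (frame T₀ i.2)) =
      ∫ y, load T₀ f (frame T₀ i.2) * legendreProd i.1 y ∂(sigma M) := by
    refine integral_congr_ae ?_
    filter_upwards [ht] with y hy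
    rw [hy, load_smul, mul_comm]
  rw [← bilinB_apply h, map_sub, LinearMap.sub_apply, bilinB_apply, bilinB_apply, hu, h2, formB,
    integral_congr_ae h1, ← integral_sub ((integrable_stiffness h w _).congr h1) (hL.const_mul _)]
  simp only [residual, sub_mul]

/-- The upper frame bound: testing `B z` against a finite part of the family `L_ν ψ_lam`. -/
lemma sum_formB_sq_le (h : IsAdmissible T₀ θ₀ θ) {c C : ℝ} (hF : IsFrameBounds T₀ c C)
    (z : VV T₀ M) (s : Finset ((M →₀ ℕ) × Theta T₀)) :
    ∑ i ∈ s, formB T₀ θ₀ θ z (tens (legendreLp i.1) (frame T₀ i.2)) ^ 2 ≤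
      C ^ 2 * CB T₀ θ₀ θ * formB T₀ θ₀ θ z z := by
  set a : (M →₀ ℕ) × Theta T₀ → ℝ :=
    fun i => formB T₀ θ₀ θ z (tens (legendreLp i.1) (frame T₀ i.2)) with ha
  -- the test function built from the coefficients themselves
  set v := ∑ i ∈ s, a i • tens (legendreLp i.1) (frame T₀ i.2) with hv
  have h1 : formB T₀ θ₀ θ z v = ∑ i ∈ s, a i ^ 2 := by
    rw [← bilinB_apply h, hv, map_sum]
    refine Finset.sum_congr rfl fun i _ => ?_
    rw [map_smul, bilinB_apply, smul_eq_mul, sq]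
  have h2 := norm_sq_sum_tens_synthesis_le orthonormal_legendreLp hF.sum_inner_sq_le s a
  have h3 : (∑ i ∈ s, a i ^ 2) ^ 2 ≤
      formB T₀ θ₀ θ z z * (CB T₀ θ₀ θ * (C ^ 2 * ∑ i ∈ s, a i ^ 2)) := by
    rw [← h1]
    refine (formB_sq_le h z v).trans (mul_le_mul_of_nonneg_left ?_ (formB_self_nonneg h z))
    rw [h1]
    exact (formB_le_CB_mul_norm_sq h v).trans (mul_le_mul_of_nonneg_left h2 CB_nonneg)
  rcases (Finset.sum_nonneg fun i _ => sq_nonneg (a i) : 0 ≤ ∑ i ∈ s, a i ^ 2).eq_or_lt with h0 | h0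
  · rw [← h0]
    exact mul_nonneg (mul_nonneg (sq_nonneg _) CB_nonneg) (formB_self_nonneg h z)
  · refine le_of_mul_le_mul_right ?_ h0
    linarith

/-- The lower frame bound: the energy of `z` is controlled by the frame coefficients of `B z`. -/
lemma formB_le_ellTwo_sq (h : IsAdmissible T₀ θ₀ θ) {c C : ℝ} (hc : 0 < c)
    (hF : IsFrameBounds T₀ c C) (z : VV T₀ M) {ρ : (M →₀ ℕ) × Theta T₀ → ℝ}
    (hρ : ∀ i, ρ i = formB T₀ θ₀ θ z (tens (legendreLp i.1) (frame T₀ i.2)))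
    (hfin : ellTwo ρ ≠ ∞) :
    c ^ 2 * cB T₀ θ₀ θ * formB T₀ θ₀ θ z z ≤ (ellTwo ρ).toReal ^ 2 := by
  set R := (ellTwo ρ).toReal with hR
  have hR0 : 0 ≤ R := ENNReal.toReal_nonneg
  have hsum : ∀ s : Finset (M →₀ ℕ),
      ∑ ν ∈ s, ‖(functionalB h z).comp (tensL (legendreLp ν))‖ ^ 2 ≤ (R / c) ^ 2 := fun s => by
    have h1 : ENNReal.ofReal (∑ ν ∈ s,
        c ^ 2 * ‖(functionalB h z).comp (tensL (legendreLp ν))‖ ^ 2) ≤ ENNReal.ofReal (R ^ 2) := by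
      rw [ENNReal.ofReal_sum_of_nonneg fun _ _ => by positivity, ENNReal.ofReal_pow hR0,
        hR, ENNReal.ofReal_toReal hfin, ellTwo_sq,
        ENNReal.tsum_prod (f := fun ν k => ‖ρ (ν, k)‖ₑ ^ 2)]
      refine le_trans (Finset.sum_le_sum fun ν _ => ?_) (ENNReal.sum_le_tsum s)
      refine (hF _).1.trans (le_of_eq ?_)
      simp only [frameSum, hρ]
      rfl
    rw [ENNReal.ofReal_le_ofReal_iff (by positivity), ← Finset.mul_sum] at h1
    rw [div_pow, le_div_iff₀ (by positivity)]
    linarith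
  have h1 := abs_apply_le_of_sum_norm_sq_le orthonormal_legendreLp dense_span_legendreLp
    (functionalB h z) (div_nonneg hR0 hc.le) hsum z
  rw [functionalB_apply, abs_of_nonneg (formB_self_nonneg h z)] at h1
  have hz := formB_self_nonneg h z
  have hcB := h.elliptic.2
  have h2 : c * formB T₀ θ₀ θ z z ≤ R * ‖z‖ := by
    have := mul_le_mul_of_nonneg_left h1 hc.le
    rwa [← mul_assoc, mul_div_cancel₀ _ hc.ne'] at this
  have h3 : (c * formB T₀ θ₀ θ z z) ^ 2 ≤ R ^ 2 * ‖z‖ ^ 2 := by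
    rw [← mul_pow]
    exact pow_le_pow_left₀ (mul_nonneg hc.le hz) h2 2
  have h4 := mul_le_mul_of_nonneg_left (cB_mul_norm_sq_le_formB h z) (sq_nonneg R)
  rcases hz.eq_or_lt with h0 | h0
  · rw [← h0, mul_zero]
    exact sq_nonneg _
  · refine le_of_mul_le_mul_right ?_ h0
    have h5 := mul_le_mul_of_nonneg_left h3 hcB.le
    linarith

/-- This needs `V ≠ {0}`: on a null set `D`, the constant `C_B` would be `0`. -/
lemma cB_le_CB (hV : feSpace T₀ T₀.cells ≠ ⊥) (h : IsAdmissible T₀ θ₀ θ) :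
    cB T₀ θ₀ θ ≤ CB T₀ θ₀ θ := by
  obtain ⟨v, hv⟩ := exists_ne_zero hV
  have hv' : 0 < ‖v‖ := norm_pos_iff.2 hv
  have y : Y M := fun _ => ⟨0, by norm_num⟩
  exact le_of_mul_le_mul_right ((cB_mul_norm_sq_le_stiffness h y v).trans
    (stiffness_le_CB_mul_norm_sq h y v)) (by positivity)

/-- Galerkin orthogonality, as Pythagoras' theorem in the energy norm. -/
lemma formB_sub_eq_add (h : IsAdmissible T₀ θ₀ θ) {f : Pt → ℝ} {u u' w : VV T₀ M}
    (hu : ∀ v : VV T₀ M, formB T₀ θ₀ θ u v = loadPhi T₀ f v) {𝕋 : MeshFamily T₀ M}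
    (hu' : 𝕋.IsGalerkinSolution θ₀ θ f u') (hw : w ∈ 𝕋.space) :
    formB T₀ θ₀ θ (u - w) (u - w) =
      formB T₀ θ₀ θ (u - u') (u - u') + formB T₀ θ₀ θ (w - u') (w - u') := by
  have h1 : formB T₀ θ₀ θ (u - u') (w - u') = 0 := by
    rw [← bilinB_apply h, LinearMap.BilinForm.sub_left, bilinB_apply, bilinB_apply, hu,
      hu'.2 _ (MeshFamily.sub_mem_space hw hu'.1), sub_self]
  have h2 : u - w = (u - u') - (w - u') := by abel
  have h3 : formB T₀ θ₀ θ (w - u') (u - u') = 0 := by rw [formB_comm, h1]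
  have h4 : ∀ a b : VV T₀ M, formB T₀ θ₀ θ (a - b) (a - b) = formB T₀ θ₀ θ a a -
      formB T₀ θ₀ θ a b - formB T₀ θ₀ θ b a + formB T₀ θ₀ θ b b := fun a b => by
    simp only [← bilinB_apply h, LinearMap.BilinForm.sub_left, LinearMap.BilinForm.sub_right]
    ring
  rw [h2, h4, h1, h3]
  ring

/-- The error reduction for given frame bounds, in terms of squared energy norms. -/
lemma formB_reduction (h : IsAdmissible T₀ θ₀ θ) {f : Pt → ℝ} {u : VV T₀ M}
    (hu : ∀ v : VV T₀ M, formB T₀ θ₀ θ u v = loadPhi T₀ f v)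
    {𝕋 : MeshFamily T₀ M} {w : VV T₀ M} (hw : w ∈ 𝕋.space) {ζ ω₀ : ℝ} (hζ : 0 ≤ ζ) (hω₀ : 0 < ω₀)
    (hζω : (1 + ω₀) * ζ < ω₀) {r : (M →₀ ℕ) × Theta T₀ → ℝ}
    (hres : ellTwo (residual T₀ θ₀ θ f w - r) ≤
      ENNReal.ofReal ζ * ellTwo (residual T₀ θ₀ θ f w))
    {Λ : Set ((M →₀ ℕ) × Theta T₀)}
    (hbulk : ENNReal.ofReal ω₀ * ellTwo r ≤ ellTwo (Λ.indicator r)) (hΛ : 𝕋.IsRefine Λ)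
    {u' : VV T₀ M} (hu' : 𝕋.IsGalerkinSolution θ₀ θ f u') {c C : ℝ} (hc : 0 < c)
    (hF : IsFrameBounds T₀ c C) :
    (ω₀ - (1 + ω₀) * ζ) ^ 2 * (c ^ 2 * cB T₀ θ₀ θ) * formB T₀ θ₀ θ (u - w) (u - w) ≤
      C ^ 2 * CB T₀ θ₀ θ *
        (formB T₀ θ₀ θ (u - w) (u - w) - formB T₀ θ₀ θ (u - u') (u - u')) := by
  set ρ := residual T₀ θ₀ θ f w with hρ
  have hK : 0 ≤ C ^ 2 * CB T₀ θ₀ θ := mul_nonneg (sq_nonneg _) CB_nonneg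
  have hsymm : formB T₀ θ₀ θ (w - u) (w - u) = formB T₀ θ₀ θ (u - w) (u - w) := by
    rw [← neg_sub u w, ← bilinB_apply h, LinearMap.BilinForm.neg_left,
      LinearMap.BilinForm.neg_right, neg_neg, bilinB_apply]
  have hfin : ellTwo ρ ≠ ∞ := by
    have hE : 0 ≤ C ^ 2 * CB T₀ θ₀ θ * formB T₀ θ₀ θ (w - u) (w - u) :=
      mul_nonneg hK (formB_self_nonneg h _)
    refine ((ellTwo_le_ofReal (Real.sqrt_nonneg
      (C ^ 2 * CB T₀ θ₀ θ * formB T₀ θ₀ θ (w - u) (w - u))) fun s => ?_).trans_lt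
      ENNReal.ofReal_lt_top).ne
    rw [Real.sq_sqrt hE]
    simp only [hρ, residual_eq h hu]
    exact sum_formB_sq_le h hF _ s
  have hlow := formB_le_ellTwo_sq h hc hF (w - u) (ρ := ρ) (residual_eq h hu w) hfin
  have hbulk' := bulk_of_approx_bulk hζ hω₀ hfin hres hbulk
  -- on `Λ` the exact solution may be replaced by the Galerkin solution
  have hup : ellTwo (Λ.indicator ρ) ≤
      ENNReal.ofReal √(C ^ 2 * CB T₀ θ₀ θ * formB T₀ θ₀ θ (w - u') (w - u')) := by
    refine ellTwo_le_ofReal (Real.sqrt_nonneg _) fun s => ?_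
    rw [Real.sq_sqrt (mul_nonneg hK (formB_self_nonneg h _))]
    refine le_trans (Finset.sum_le_sum fun i _ => ?_) (sum_formB_sq_le h hF (w - u') s)
    by_cases hi : i ∈ Λ
    · rw [indicator_of_mem hi, hρ, residual_eq h hu]
      simp only [← bilinB_apply h, map_sub, LinearMap.sub_apply]
      simp only [bilinB_apply]
      rw [hu, hu'.2 _ (MeshFamily.tens_mem_space hΛ hi)]
    · rw [indicator_of_notMem hi]
      simpa using sq_nonneg _
  have hup' := ENNReal.toReal_le_of_le_ofReal (Real.sqrt_nonneg _) hup
  have hκ : 0 ≤ ω₀ - (1 + ω₀) * ζ := by linarith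
  have h1 : ((ω₀ - (1 + ω₀) * ζ) * (ellTwo ρ).toReal) ^ 2 ≤
      C ^ 2 * CB T₀ θ₀ θ * formB T₀ θ₀ θ (w - u') (w - u') := by
    rw [← Real.sq_sqrt (mul_nonneg hK (formB_self_nonneg h (w - u')))]
    exact pow_le_pow_left₀ (mul_nonneg hκ ENNReal.toReal_nonneg) (hbulk'.trans hup') 2
  have hpyth := formB_sub_eq_add h hu hu' hw
  rw [hsymm] at hlow
  have h2 := mul_le_mul_of_nonneg_left hlow (sq_nonneg (ω₀ - (1 + ω₀) * ζ))
  rw [hpyth, add_sub_cancel_left, ← hpyth]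
  rw [mul_pow] at h1
  linarith

lemma one_le_condition (hV : feSpace T₀ T₀.cells ≠ ⊥) (h : IsAdmissible T₀ θ₀ θ) {c C : ℝ}
    (hc : 0 < c) (hF : IsFrameBounds T₀ c C) :
    1 ≤ C ^ 2 * CB T₀ θ₀ θ / (c ^ 2 * cB T₀ θ₀ θ) := by
  have hcB := h.elliptic.2
  rw [one_le_div (by positivity)]
  exact mul_le_mul (hF.le hV) (cB_le_CB hV h) hcB.le (sq_nonneg _)

lemma normB_le_sqrt_mul (h : IsAdmissible T₀ θ₀ θ) {v e : VV T₀ M} {x : ℝ}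
    (hx : formB T₀ θ₀ θ v v ≤ x * formB T₀ θ₀ θ e e) :
    normB T₀ θ₀ θ v ≤ √x * normB T₀ θ₀ θ e := by
  rw [normB, normB, ← Real.sqrt_mul' _ (formB_self_nonneg h e)]
  exact Real.sqrt_le_sqrt hx

end Saturation

end SGFEM

end

theorem mainTheorem2 (T₀ : SGFEM.InitialTriangulation)
    (hV : SGFEM.feSpace T₀ T₀.cells ≠ ⊥)
    {M : Type*} [Countable M] (θ₀ : SGFEM.Pt → ℝ) (θ : M → SGFEM.Pt → ℝ)
    (hθ₀ : MemLp θ₀ ∞ (volume.restrict T₀.domain))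
    (hθ : ∀ μ, MemLp (θ μ) ∞ (volume.restrict T₀.domain))
    (hell : SGFEM.UniformlyElliptic T₀ θ₀ θ)
    (f : SGFEM.Pt → ℝ) (hf : MemLp f 2 (volume.restrict T₀.domain))
    (u : SGFEM.VV T₀ M)
    (hu : ∀ v : SGFEM.VV T₀ M, SGFEM.formB T₀ θ₀ θ u v = SGFEM.loadPhi T₀ f v)
    (𝕋 𝕋' : SGFEM.MeshFamily T₀ M) (w : SGFEM.VV T₀ M) (hw : w ∈ 𝕋.space)
    (ζ ω₀ : ℝ) (hζ : ζ ∈ Ioo (0 : ℝ) (1 / 2)) (hω₀ : ω₀ ∈ Ioc (0 : ℝ) 1)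
    (hζω : (1 + ω₀) * ζ < ω₀)
    (r : (M →₀ ℕ) × SGFEM.Theta T₀ → ℝ) (hr : Memℓp r 2)
    (hres : SGFEM.ellTwo (SGFEM.residual T₀ θ₀ θ f w - r) ≤
      ENNReal.ofReal ζ * SGFEM.ellTwo (SGFEM.residual T₀ θ₀ θ f w))
    (Λ : Set ((M →₀ ℕ) × SGFEM.Theta T₀))
    (hbulk : ENNReal.ofReal ω₀ * SGFEM.ellTwo r ≤ SGFEM.ellTwo (Λ.indicator r))
    (hΛ : 𝕋'.IsRefine Λ) (href : 𝕋.RefinedBy 𝕋')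
    (u' : SGFEM.VV T₀ M) (hu' : 𝕋'.IsGalerkinSolution θ₀ θ f u') :
    SGFEM.normB T₀ θ₀ θ (u - u') ≤
        √(1 - (ω₀ - (1 + ω₀) * ζ) ^ 2 * ((SGFEM.saturationConst T₀ θ₀ θ)⁻¹).toReal) *
          SGFEM.normB T₀ θ₀ θ (u - w) ∧
      ∀ c C : ℝ, 0 < c → 0 < C → SGFEM.IsFrameBounds T₀ c C →
        1 ≤ C ^ 2 * SGFEM.CB T₀ θ₀ θ / (c ^ 2 * SGFEM.cB T₀ θ₀ θ) ∧
        SGFEM.normB T₀ θ₀ θ (u - u') ≤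
          √(1 - (ω₀ - (1 + ω₀) * ζ) ^ 2 /
              (C ^ 2 * SGFEM.CB T₀ θ₀ θ / (c ^ 2 * SGFEM.cB T₀ θ₀ θ))) *
            SGFEM.normB T₀ θ₀ θ (u - w) := by
  have h : SGFEM.IsAdmissible T₀ θ₀ θ := ⟨hθ₀, hθ, hell⟩
  have hcB := hell.2
  have hCB : 0 < SGFEM.CB T₀ θ₀ θ := hcB.trans_le (SGFEM.cB_le_CB hV h)
  have hw' : w ∈ 𝕋'.space := SGFEM.MeshFamily.space_mono href hw
  have hmain : ∀ c C : ℝ, 0 < c → 0 < C → SGFEM.IsFrameBounds T₀ c C →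
      SGFEM.normB T₀ θ₀ θ (u - u') ≤
        √(1 - (ω₀ - (1 + ω₀) * ζ) ^ 2 /
            (C ^ 2 * SGFEM.CB T₀ θ₀ θ / (c ^ 2 * SGFEM.cB T₀ θ₀ θ))) *
          SGFEM.normB T₀ θ₀ θ (u - w) := by
    intro c C hc hC hF
    refine SGFEM.normB_le_sqrt_mul h ?_
    have h1 := SGFEM.formB_reduction h hu hw' hζ.1.le hω₀.1 hζω hres hbulk hΛ hu' hc hF
    have hA : 0 < C ^ 2 * SGFEM.CB T₀ θ₀ θ := by positivity
    rw [div_div_eq_mul_div, sub_mul, one_mul, le_sub_comm, div_mul_eq_mul_div, div_le_iff₀ hA,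
      mul_comm _ (C ^ 2 * SGFEM.CB T₀ θ₀ θ)]
    exact h1
  refine ⟨?_, fun c C hc hC hF => ⟨SGFEM.one_le_condition hV h hc hF, hmain c C hc hC hF⟩⟩
  by_cases hdeg : SGFEM.lowerFrameBoundSq T₀ = 0 ∨ SGFEM.upperFrameBoundSq T₀ = ∞
  · -- without finite positive frame bounds, Galerkin orthogonality gives the claim
    rw [SGFEM.toReal_inv_saturationConst_eq_zero hCB hdeg]
    refine SGFEM.normB_le_sqrt_mul h ?_
    have := SGFEM.formB_sub_eq_add h hu hu' hw'
    have := SGFEM.formB_self_nonneg h (w - u')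
    linarith
  · obtain ⟨hL0, hU⟩ := not_or.1 hdeg
    have hLU := SGFEM.lowerFrameBoundSq_le_upperFrameBoundSq hV
    have hL : SGFEM.lowerFrameBoundSq T₀ ≠ ∞ := (hLU.trans_lt (Ne.lt_top hU)).ne
    have hU0 : SGFEM.upperFrameBoundSq T₀ ≠ 0 := ((pos_iff_ne_zero.2 hL0).trans_le hLU).ne'
    rw [SGFEM.toReal_inv_saturationConst hcB, ← div_eq_mul_inv]
    exact hmain _ _ (Real.sqrt_pos.2 (ENNReal.toReal_pos hL0 hL))
      (Real.sqrt_pos.2 (ENNReal.toReal_pos hU0 hU)) (SGFEM.isFrameBounds_best hL hU)
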